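/- Let $N,M_F,M_B$ be nonnegative integers, $M=M_F+M_B$, with $1\le M\le N$. Consider the linear system $x_{k+1}=A_kx_k+B_ku_k+w_k$, $0\le k\le N-1$, with state $x_k\in\mathbb R^n$, control $u_k\in\mathbb R^s$ and deterministic initial state $x_0$. The disturbances $w_0,\dots,w_{N-1}$ are independent and square integrable, with mean zero and covariance matrices $W_k$. Independently of them, the ON/OFF state $\tau_0,\dots,\tau_{N-1}\in\{0,1\}$ of a remote controller is a Markov chain with deterministic initial value $\tau_0$ and transition probabilities $\mathbb P(\tau_{k+1}=1\mid\tau_k=1)=p$ and $\mathbb P(\tau_{k+1}=1\mid\tau_k=0)=1-q$, where $p,q\in[0,1]$. A measurement $x_i$ arrives at the controller at time $i+M_F$ and is received if $\tau_{i+M_F}=1$. The control applied at time $k$ is generated at time $k-M_B$, and controls arrive only at the times $k\in\{M,2M,\dots\}$, $k\le N-1$. A feasible policy is a sequence of measurable functions $\pi_0,\dots,\pi_{N-1}$ giving $u_k=\pi_k(H_k,\tau_{k-M_B})$ from the history $H_k$, which consists of the received measurements $x_i$ with $i\le k-M$ (and of which ones they are) and the controls $u_i$ with $i<k$, such that $u_k=0$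 unless $k$ is a positive multiple of $M$, and $\pi_k(H_k,0)=0$. Let $$J(\pi)=\mathbb E\Big[x_N^\top Q_Nx_N+\sum_{k=0}^{N-1}\big(x_k^\top Q_kx_k+u_k^\top R_ku_k\big)\Big]\in[0,\infty],$$ where all $Q_k$ are symmetric positive semidefinite and all $R_k$ symmetric positive definite, and let $J^\star$ be the infimum of $J$ over all feasible policies. Define $K_N=Q_N$ and, for $k=N-1,\dots,0$, $$V_k=(R_k+B_k^\top K_{k+1}B_k)^{-1}B_k^\top K_{k+1}A_k,\quad L_k=Q_k+A_k^\top K_{k+1}A_k,\quad \Lambda_k=A_k^\top K_{k+1}B_kV_k,$$ $$K_k=\begin{cases}L_k-p\Lambda_k& M\mid k,\\ L_k& M\nmid k.\end{cases}$$ Let $c=(N-a)/M$, where $a=M$ if $M\mid N$ and $a=N\bmod M$ otherwise; let $P_{cM}=\Lambda_{cM}$ and, for $k=cM-1,\dots,0$, $P_k=\Lambda_k$ if $M\mid k$ and $P_k=A_k^\top P_{k+1}A_k$ if $M\nmid k$. Assume $p=1-q$. Then there is a feasible policy $\pi^\star$, independent of $x_0$ and $\tau_0$, with $J(\pi^\star)=J^\star<\infty$.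 Under $\pi^\star$, for $1\le k\le N-1$, $u_k$ is a function of $\lambda_k=(x_{k-M},u_{k-M})$ and $\tau_{k-M_B}$ when $M\mid k$, and almost surely $$u_k=\begin{cases}0& M\nmid k,\\ -V_k\,\mathbb E[x_k\mid\lambda_k]\,\mathbf 1\{\tau_{k-M_B}=1\}& M\mid k,\end{cases}$$ where $\mathbb E[x_k\mid\lambda_k]$ is the linear predictor obtained from $x_{k-M}$ by applying the control $u_{k-M}$ at time $k-M$ and no control or disturbance afterwards. Every feasible policy attaining $J^\star$ produces almost surely the same controls. If moreover $M_F\ge1$ (or $N=M$), then $$J^\star=x_0^\top L_0x_0+\sum_{k=0}^{N-1}\operatorname{tr}(K_{k+1}W_k)+p\sum_{k=0}^{cM-1}\operatorname{tr}(P_{k+1}W_k).$$ -/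

import Mathlib

open MeasureTheory ProbabilityTheory Matrix

noncomputable section

/-- The data of a linear system with `n`-dimensional state and `s`-dimensional control, horizon `N`,
quadratic cost weights `Q k`, `R k`, disturbance covariances `W k`, forward and backward delays
`MF`, `MB`, and transition parameters `p`, `q` of the ON/OFF chain of the remote controller. -/
structure FogSystem (n s : ℕ) where
  N : ℕ
  MF : ℕ
  MB : ℕ
  A : ℕ → Matrix (Fin n) (Fin n) ℝ
  B : ℕ → Matrix (Fin n) (Fin s) ℝ
  Q : ℕ → Matrix (Fin n) (Fin n) ℝ
  R : ℕ → Matrix (Fin s) (Fin s) ℝ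
  W : ℕ → Matrix (Fin n) (Fin n) ℝ
  p : ℝ
  q : ℝ

/-- What the controller knows. `meas i = (true, x_i)` if the measurement `x_i` has been received, and
`meas i = (false, 0)` if it has not; `ctrl i` is the control applied at time `i` (`0` if `i` is not in
the past). -/
abbrev FogHistory (n s : ℕ) : Type :=
  (ℕ → Bool × (Fin n → ℝ)) × (ℕ → Fin s → ℝ)

/-- A control policy: `π k H t` is the control applied at time `k`, when `H` is the available history
and `t` is the ON/OFF state of the controller at the moment when that control is generated. -/
abbrev FogPolicy (n s : ℕ) : Type :=
  ℕ → FogHistory n s → Bool → (Fin s → ℝ)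

/-- One-step transition probabilities of the ON/OFF chain (`true` is ON). -/
def onOffTransition (p q : ℝ) : Bool → Bool → ℝ
  | true, true => p
  | true, false => 1 - p
  | false, true => 1 - q
  | false, false => q

namespace FogSystem

variable {n s : ℕ} (S : FogSystem n s)

/-- The total round-trip delay. -/
def M : ℕ := S.MF + S.MB

/-- The deterministic assumptions: positive semidefinite state weights, positive definite control
weights, and transition parameters that are probabilities. -/
structure IsValid : Prop where
  posSemidef_Q : ∀ k ≤ S.N, (S.Q k).PosSemidef
  posDef_R : ∀ k < S.N, (S.R k).PosDef
  p_mem : S.p ∈ Set.Icc (0 : ℝ) 1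
  q_mem : S.q ∈ Set.Icc (0 : ℝ) 1

/-- The probabilistic assumptions on the disturbances `w 0, …, w (N-1)` and on the ON/OFF states
`τ 0, …, τ (N-1)`, the latter being a Markov chain started at `τ₀`. -/
structure IsNoiseModel {Ω : Type*} [MeasurableSpace Ω] (μ : Measure Ω)
    (w : ℕ → Ω → Fin n → ℝ) (τ : ℕ → Ω → Bool) (τ₀ : Bool) : Prop where
  measurable_w : ∀ k < S.N, Measurable (w k)
  memLp_w : ∀ k < S.N, MemLp (w k) 2 μ
  mean_w : ∀ k < S.N, ∫ ω, w k ω ∂μ = 0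
  cov_w : ∀ k < S.N, ∀ i j, cov[fun ω => w k ω i, fun ω => w k ω j; μ] = S.W k i j
  indep_w : iIndepFun (fun (k : Fin S.N) => w k) μ
  measurable_τ : ∀ k < S.N, Measurable (τ k)
  initial_τ : ∀ᵐ ω ∂μ, τ 0 ω = τ₀
  markov_τ : ∀ k, k + 1 < S.N → ∀ b : ℕ → Bool,
    μ.real {ω | ∀ i ≤ k + 1, τ i ω = b i} =
      μ.real {ω | ∀ i ≤ k, τ i ω = b i} * onOffTransition S.p S.q (b k) (b (k + 1))
  indep_w_τ : IndepFun (fun ω (k : Fin S.N) => w k ω) (fun ω (k : Fin S.N) => τ k ω) μ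

/-! ### Closed-loop evolution -/

/-- The history on which the control applied at time `k` may depend, along a path with states `x`,
controls `u` and ON/OFF states `t`. The measurement `x i` reaches the controller at time `i + MF`, is
received if the controller is then ON, and can influence controls applied from time `i + M` on. -/
def history (x : ℕ → Fin n → ℝ) (u : ℕ → Fin s → ℝ) (t : ℕ → Bool) (k : ℕ) : FogHistory n s :=
  (fun i => if i + S.M ≤ k ∧ t (i + S.MF) = true then (true, x i) else (false, 0),
   fun i => if i < k then u i else 0)

/-- Auxiliary recursion: after `k` steps the states at times `≤ k` and the controls at times `< k`
have been filled in. -/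
def run (π : FogPolicy n s) (x₀ : Fin n → ℝ) (w : ℕ → Fin n → ℝ) (t : ℕ → Bool) :
    ℕ → (ℕ → Fin n → ℝ) × (ℕ → Fin s → ℝ)
  | 0 => (fun _ => x₀, fun _ => 0)
  | k + 1 =>
    let x := (run π x₀ w t k).1
    let u := (run π x₀ w t k).2
    let uk := π k (S.history x u t k) (t (k - S.MB))
    (Function.update x (k + 1) (S.A k *ᵥ x k + S.B k *ᵥ uk + w k), Function.update u k uk)

/-- The state `x_k` under policy `π`, for given realizations of disturbances and ON/OFF states. -/
def state (π : FogPolicy n s) (x₀ : Fin n → ℝ) (w : ℕ → Fin n → ℝ) (t : ℕ → Bool) (k : ℕ) :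
    Fin n → ℝ :=
  (S.run π x₀ w t k).1 k

/-- The control `u_k` applied at time `k` under policy `π`; it is generated at time `k - MB`. -/
def control (π : FogPolicy n s) (x₀ : Fin n → ℝ) (w : ℕ → Fin n → ℝ) (t : ℕ → Bool) (k : ℕ) :
    Fin s → ℝ :=
  (S.run π x₀ w t (k + 1)).2 k

section evolution

variable (π : FogPolicy n s) (x₀ : Fin n → ℝ) (w : ℕ → Fin n → ℝ) (t : ℕ → Bool)

theorem run_fst (k i : ℕ) (h : i ≤ k) : (S.run π x₀ w t k).1 i = S.state π x₀ w t i := by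
  induction k with
  | zero => obtain rfl : i = 0 := by omega
            rfl
  | succ k ih =>
    rcases Nat.lt_or_ge i (k + 1) with h' | h'
    · rw [← ih (by omega)]
      simp only [run]
      rw [Function.update_of_ne (by omega)]
    · obtain rfl : i = k + 1 := by omega
      rfl

theorem run_snd (k i : ℕ) (h : i < k) : (S.run π x₀ w t k).2 i = S.control π x₀ w t i := by
  induction k with
  | zero => omega
  | succ k ih =>
    rcases Nat.lt_or_ge i k with h' | h'
    · rw [← ih h']
      simp only [run]
      rw [Function.update_of_ne (by omega)]
    · obtain rfl : i = k := by omega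
      rfl

theorem state_zero : S.state π x₀ w t 0 = x₀ := rfl

theorem control_eq (k : ℕ) :
    S.control π x₀ w t k =
      π k (S.history (S.state π x₀ w t) (S.control π x₀ w t) t k) (t (k - S.MB)) := by
  have hh : S.history (S.run π x₀ w t k).1 (S.run π x₀ w t k).2 t k =
      S.history (S.state π x₀ w t) (S.control π x₀ w t) t k := by
    unfold history
    refine Prod.ext (funext fun i => ?_) (funext fun i => ?_)
    · by_cases hi : i + S.M ≤ k
      · simp only [S.run_fst π x₀ w t k i (by omega)]
      · simp [hi]
    · by_cases hi : i < k
      · simp only [S.run_snd π x₀ w t k i hi]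
      · simp [hi]
  rw [← hh]
  simp [control, run]

theorem state_succ (k : ℕ) :
    S.state π x₀ w t (k + 1) =
      S.A k *ᵥ S.state π x₀ w t k + S.B k *ᵥ S.control π x₀ w t k + w k := by
  simp [state, control, run]

end evolution

/-! ### Feasible policies and cost -/

/-- A policy is feasible if it is measurable, applies no control except at the positive multiples of
`M` (the times at which a requested control signal arrives), and applies no control generated while
the controller is OFF. -/
structure IsFeasible (π : FogPolicy n s) : Prop where
  measurable : ∀ k < S.N, Measurable fun h : FogHistory n s × Bool => π k h.1 h.2
  eq_zero_of_no_arrival : ∀ k < S.N, ¬ (0 < k ∧ S.M ∣ k) → ∀ H t, π k H t = 0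
  eq_zero_of_off : ∀ k < S.N, ∀ H, π k H false = 0

/-- The total quadratic cost of a path. -/
def pathCost (x : ℕ → Fin n → ℝ) (u : ℕ → Fin s → ℝ) : ℝ :=
  x S.N ⬝ᵥ (S.Q S.N *ᵥ x S.N) +
    ∑ k ∈ Finset.range S.N, (x k ⬝ᵥ (S.Q k *ᵥ x k) + u k ⬝ᵥ (S.R k *ᵥ u k))

section cost

variable {Ω : Type*} [MeasurableSpace Ω]

/-- The expected total cost of a policy; the path cost is nonnegative, so that the expectation makes
sense in `[0, ∞]` for every policy. -/
def cost (μ : Measure Ω) (w : ℕ → Ω → Fin n → ℝ) (τ : ℕ → Ω → Bool) (x₀ : Fin n → ℝ)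
    (π : FogPolicy n s) : ENNReal :=
  ∫⁻ ω, ENNReal.ofReal (S.pathCost (S.state π x₀ (fun k => w k ω) (fun k => τ k ω))
    (S.control π x₀ (fun k => w k ω) (fun k => τ k ω))) ∂μ

/-- The infimum of the expected total cost over all feasible policies. -/
def minCost (μ : Measure Ω) (w : ℕ → Ω → Fin n → ℝ) (τ : ℕ → Ω → Bool) (x₀ : Fin n → ℝ) :
    ENNReal :=
  ⨅ (π : FogPolicy n s) (_ : S.IsFeasible π), S.cost μ w τ x₀ π

/-- The random state at time `k`. -/
def stateProc (w : ℕ → Ω → Fin n → ℝ) (τ : ℕ → Ω → Bool) (x₀ : Fin n → ℝ)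
    (π : FogPolicy n s) (k : ℕ) (ω : Ω) : Fin n → ℝ :=
  S.state π x₀ (fun i => w i ω) (fun i => τ i ω) k

/-- The random control at time `k`. -/
def controlProc (w : ℕ → Ω → Fin n → ℝ) (τ : ℕ → Ω → Bool) (x₀ : Fin n → ℝ)
    (π : FogPolicy n s) (k : ℕ) (ω : Ω) : Fin s → ℝ :=
  S.control π x₀ (fun i => w i ω) (fun i => τ i ω) k

/-- The conditional expectation `E[x_k | x_{k-M}, u_{k-M}]` under policy `π`. -/
def condMean (μ : Measure Ω) (w : ℕ → Ω → Fin n → ℝ) (τ : ℕ → Ω → Bool) (x₀ : Fin n → ℝ)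
    (π : FogPolicy n s) (k : ℕ) : Ω → Fin n → ℝ :=
  μ[S.stateProc w τ x₀ π k |
    MeasurableSpace.comap
      (fun ω => (S.stateProc w τ x₀ π (k - S.M) ω, S.controlProc w τ x₀ π (k - S.M) ω))
      inferInstance]

end cost

/-! ### The matrix recursions -/

/-- `V_k` as a function of `K_{k+1}`. -/
def gainStep (k : ℕ) (K' : Matrix (Fin n) (Fin n) ℝ) : Matrix (Fin s) (Fin n) ℝ :=
  (S.R k + (S.B k)ᵀ * K' * S.B k)⁻¹ * (S.B k)ᵀ * K' * S.A k

/-- `L_k` as a function of `K_{k+1}`. -/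
def Lstep (k : ℕ) (K' : Matrix (Fin n) (Fin n) ℝ) : Matrix (Fin n) (Fin n) ℝ :=
  S.Q k + (S.A k)ᵀ * K' * S.A k

/-- `Λ_k` as a function of `K_{k+1}`. -/
def Lamstep (k : ℕ) (K' : Matrix (Fin n) (Fin n) ℝ) : Matrix (Fin n) (Fin n) ℝ :=
  (S.A k)ᵀ * K' * S.B k * S.gainStep k K'

/-- The matrices `K_k`, by backward recursion from `K_N = Q_N` (only `k ≤ N` matters). -/
def K (k : ℕ) : Matrix (Fin n) (Fin n) ℝ :=
  if k < S.N then
    if S.M ∣ k then S.Lstep k (K (k + 1)) - S.p • S.Lamstep k (K (k + 1))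
    else S.Lstep k (K (k + 1))
  else S.Q S.N
termination_by S.N - k

def V (k : ℕ) : Matrix (Fin s) (Fin n) ℝ := S.gainStep k (S.K (k + 1))

def L (k : ℕ) : Matrix (Fin n) (Fin n) ℝ := S.Lstep k (S.K (k + 1))

def Lam (k : ℕ) : Matrix (Fin n) (Fin n) ℝ := S.Lamstep k (S.K (k + 1))

/-- `c = (N - a) / M`, where `a = M` if `M ∣ N` and `a = N mod M` otherwise. -/
def c : ℕ := (S.N - if S.M ∣ S.N then S.M else S.N % S.M) / S.M

/-- The matrices `P_k`, by backward recursion from `P_{cM} = Λ_{cM}` (only `k ≤ cM` matters). -/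
def P (k : ℕ) : Matrix (Fin n) (Fin n) ℝ :=
  if k < S.c * S.M then
    if S.M ∣ k then S.Lam k else (S.A k)ᵀ * P (k + 1) * S.A k
  else S.Lam (S.c * S.M)
termination_by S.c * S.M - k

theorem K_N : S.K S.N = S.Q S.N := by
  rw [K]; simp

theorem K_of_lt (k : ℕ) (h : k < S.N) :
    S.K k = if S.M ∣ k then S.L k - S.p • S.Lam k else S.L k := by
  rw [K, if_pos h]; rfl

theorem P_last : S.P (S.c * S.M) = S.Lam (S.c * S.M) := by
  rw [P]; simp

theorem P_of_lt (k : ℕ) (h : k < S.c * S.M) :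
    S.P k = if S.M ∣ k then S.Lam k else (S.A k)ᵀ * S.P (k + 1) * S.A k := by
  rw [P, if_pos h]

/-- The claimed minimum cost. -/
def optValue (x₀ : Fin n → ℝ) : ℝ :=
  x₀ ⬝ᵥ (S.L 0 *ᵥ x₀) + ∑ k ∈ Finset.range S.N, (S.K (k + 1) * S.W k).trace +
    S.p * ∑ k ∈ Finset.range (S.c * S.M), (S.P (k + 1) * S.W k).trace

/-! ### The candidate optimal policy -/

/-- Mean of the state `j` steps after time `i`, from state `x` at time `i`, when the control `u` is
applied at time `i` and no control afterwards. -/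
def predict (i : ℕ) (x : Fin n → ℝ) (u : Fin s → ℝ) : ℕ → Fin n → ℝ
  | 0 => x
  | j + 1 => S.A (i + j) *ᵥ predict i x u j + S.B i *ᵥ (if j = 0 then u else 0)

/-- The linear memoryless control law, a function of `λ = (x_{k-M}, u_{k-M})` and of the ON/OFF
state at time `k - MB`. -/
def optLaw (k : ℕ) (lam : (Fin n → ℝ) × (Fin s → ℝ)) (t : Bool) : Fin s → ℝ :=
  if 0 < k ∧ S.M ∣ k ∧ t = true then
    -(S.V k *ᵥ S.predict (k - S.M) lam.1 lam.2 S.M)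
  else 0

/-- The policy that applies `optLaw` to the latest measurement and the control at the same time. -/
def optPolicy : FogPolicy n s :=
  fun k H t => S.optLaw k ((H.1 (k - S.M)).2, H.2 (k - S.M)) t

end FogSystem

end

/-! The proof is dynamic programming by completing the square, carried out along an arbitrary
feasible policy with square integrable controls. Put T_k = E[x_kᵀ K_k x_k] and let G_k be
`controlWeight`. The expected cost of stage k plus T_{k+1} is E[x_kᵀ (L_k - Λ_k) x_k] + tr(K_{k+1}
W_k), plus the expectation of the penalty (u_k + V_k x_k)ᵀ G_k (u_k + V_k x_k) (`stage_cost_eq`,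
`expected_stage`). Where no control arrives, u_k = 0 and the penalty is exactly the missing Λ_k
term.

At a positive multiple k of M, x_k is the linear prediction from (x_{k-M}, u_{k-M}) plus an error
built from w_{k-M}, ..., w_{k-1}. The control cannot depend on these disturbances, and the error
does not depend on the policy. If the controller is OFF, the penalty is x_kᵀ Λ_k x_k. If it is ON,
u_k + V_k x_k is the deviation D_k from the linear law plus V_k times the error, and the cross term
has mean zero (`penalty_eq`, `expected_penalty`). Because p = 1 - q, the state τ_{k-MB} at a
positive time is independent of x_k, so the OFF case contributes (1 - p) E[x_kᵀ Λ_k x_k]. This turns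
L_k - Λ_k into K_k = L_k - p Λ_k, and the T_k telescope.

The cost is therefore a policy-independent constant plus the sum of the E[D_kᵀ G_k D_k]
(`integral_pathCost`). The linear law has D = 0. It can be implemented because x_{k-M} reaches the
controller exactly when u_k is generated, so one ON/OFF state decides both (`MF_add_eq_sub_MB`).
Positive definiteness of G_k gives uniqueness; that of R_k makes the controls of every finite-cost
policy square integrable. The one exceptional case, k - MB = 0, involves the deterministic τ_0 but
changes only the constant (`off_correction_eq`). -/

noncomputable section

/-! ### Quadratic forms and the backward matrix recursion. -/

theorem Matrix.mulVec_dotProduct_eq {m n : Type*} [Fintype m] [Fintype n] (A : Matrix m n ℝ)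
    (x : n → ℝ) (y : m → ℝ) : (A *ᵥ x) ⬝ᵥ y = x ⬝ᵥ (Aᵀ *ᵥ y) := by
  rw [dotProduct_mulVec, vecMul_transpose]

/-- A positive definite quadratic form dominates a positive multiple of the squared norm. -/
theorem Matrix.PosDef.exists_pos_mul_sq_norm_le {s : ℕ} {R : Matrix (Fin s) (Fin s) ℝ}
    (hR : R.PosDef) : ∃ r > 0, ∀ u : Fin s → ℝ, r * ‖u‖ ^ 2 ≤ u ⬝ᵥ (R *ᵥ u) := by
  have hcont : Continuous fun u : Fin s → ℝ => u ⬝ᵥ (R *ᵥ u) := by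
    simp only [dotProduct, mulVec]
    fun_prop
  -- The unit sphere is empty only for s = 0. Otherwise r is the minimum of the form on it, and
  -- homogeneity does the rest.
  rcases (Metric.sphere (0 : Fin s → ℝ) 1).eq_empty_or_nonempty with he | hne
  · refine ⟨1, one_pos, fun u => ?_⟩
    by_cases hu : u = 0
    · simp [hu]
    · have : (‖u‖⁻¹ • u) ∈ Metric.sphere (0 : Fin s → ℝ) 1 := by
        simp [norm_smul, hu]
      simp [he] at this
  · obtain ⟨v, hv, hmin⟩ := (isCompact_sphere (0 : Fin s → ℝ) 1).exists_isMinOn hne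
      hcont.continuousOn
    have hv0 : v ≠ 0 := by
      rintro rfl
      simp at hv
    refine ⟨v ⬝ᵥ (R *ᵥ v), by simpa using hR.dotProduct_mulVec_pos hv0, fun u => ?_⟩
    by_cases hu : u = 0
    · simp [hu]
    · have hmem : (‖u‖⁻¹ • u) ∈ Metric.sphere (0 : Fin s → ℝ) 1 := by
        simp [norm_smul, hu]
      have h := hmin hmem
      simp only [Set.mem_ofPred_eq, mulVec_smul, smul_dotProduct, dotProduct_smul,
        smul_eq_mul] at h
      have hpos : 0 < ‖u‖ := norm_pos_iff.mpr hu
      calc _ ≤ ‖u‖⁻¹ * (‖u‖⁻¹ * u ⬝ᵥ (R *ᵥ u)) * ‖u‖ ^ 2 := by gcongr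
        _ = _ := by field_simp

namespace FogSystem

variable {n s : ℕ} (S : FogSystem n s)

/-- The weight `R_k + B_kᵀ K_{k+1} B_k` of the control in the one-step cost-to-go. -/
def controlWeight (k : ℕ) : Matrix (Fin s) (Fin s) ℝ :=
  S.R k + (S.B k)ᵀ * S.K (k + 1) * S.B k

variable {S}

theorem posDef_controlWeight (hS : S.IsValid) {k : ℕ} (hk : k < S.N)
    (hK : (S.K (k + 1)).PosSemidef) : (S.controlWeight k).PosDef := by
  have := hK.conjTranspose_mul_mul_same (S.B k)
  rw [conjTranspose_eq_transpose_of_trivial] at this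
  exact (hS.posDef_R k hk).add_posSemidef this

/-- The normal equation of the one-step minimisation: it characterises the gain without the explicit
inverse. -/
theorem controlWeight_mul_V {k : ℕ} (hG : (S.controlWeight k).PosDef) :
    S.controlWeight k * S.V k = (S.B k)ᵀ * S.K (k + 1) * S.A k := by
  have hu : IsUnit (S.controlWeight k).det := isUnit_iff_ne_zero.mpr hG.det_pos.ne'
  have : S.V k = (S.controlWeight k)⁻¹ * ((S.B k)ᵀ * S.K (k + 1) * S.A k) := by
    simp only [V, gainStep, controlWeight, Matrix.mul_assoc]
  rw [this, ← Matrix.mul_assoc, Matrix.mul_nonsing_inv _ hu, Matrix.one_mul]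

theorem transpose_eq_of_isHermitian {m : ℕ} {X : Matrix (Fin m) (Fin m) ℝ}
    (hX : X.IsHermitian) : Xᵀ = X := by
  rw [← conjTranspose_eq_transpose_of_trivial]; exact hX

/-- This form shows that Λ_k is positive semidefinite and is the penalty incurred by applying no
control. -/
theorem Lam_eq {k : ℕ} (hK : (S.K (k + 1)).IsHermitian) (hG : (S.controlWeight k).PosDef) :
    S.Lam k = (S.V k)ᵀ * S.controlWeight k * S.V k := by
  have h := congrArg Matrix.transpose (controlWeight_mul_V hG)
  simp only [transpose_mul, transpose_transpose, transpose_eq_of_isHermitian hK,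
    transpose_eq_of_isHermitian hG.1] at h
  rw [h]
  simp only [Lam, Lamstep, V, Matrix.mul_assoc]

theorem dotProduct_Lam {k : ℕ} (hK : (S.K (k + 1)).IsHermitian)
    (hG : (S.controlWeight k).PosDef) (x : Fin n → ℝ) :
    x ⬝ᵥ (S.Lam k *ᵥ x) = (S.V k *ᵥ x) ⬝ᵥ (S.controlWeight k *ᵥ (S.V k *ᵥ x)) := by
  rw [Lam_eq hK hG, mulVec_dotProduct_eq]
  simp only [mulVec_mulVec, Matrix.mul_assoc]

theorem posSemidef_Lam {k : ℕ} (hK : (S.K (k + 1)).IsHermitian)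
    (hG : (S.controlWeight k).PosDef) : (S.Lam k).PosSemidef := by
  rw [Lam_eq hK hG, ← conjTranspose_eq_transpose_of_trivial]
  exact hG.posSemidef.conjTranspose_mul_mul_same _

/-- Completing the square in the one-step cost-to-go. -/
theorem stage_cost_eq {k : ℕ} (hK : (S.K (k + 1)).IsHermitian)
    (hG : (S.controlWeight k).PosDef) (x : Fin n → ℝ) (u : Fin s → ℝ) :
    x ⬝ᵥ (S.Q k *ᵥ x) + u ⬝ᵥ (S.R k *ᵥ u) +
      (S.A k *ᵥ x + S.B k *ᵥ u) ⬝ᵥ (S.K (k + 1) *ᵥ (S.A k *ᵥ x + S.B k *ᵥ u)) =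
    x ⬝ᵥ (S.L k *ᵥ x) - x ⬝ᵥ (S.Lam k *ᵥ x) +
      (u + S.V k *ᵥ x) ⬝ᵥ (S.controlWeight k *ᵥ (u + S.V k *ᵥ x)) := by
  have hGV : S.controlWeight k *ᵥ (S.V k *ᵥ x) =
      (S.B k)ᵀ *ᵥ (S.K (k + 1) *ᵥ (S.A k *ᵥ x)) := by
    rw [mulVec_mulVec, controlWeight_mul_V hG]; simp only [mulVec_mulVec, Matrix.mul_assoc]
  have hKs := transpose_eq_of_isHermitian hK
  have hGs := transpose_eq_of_isHermitian hG.1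
  have h1 : (S.V k *ᵥ x) ⬝ᵥ (S.controlWeight k *ᵥ u) =
      (S.A k *ᵥ x) ⬝ᵥ (S.K (k + 1) *ᵥ (S.B k *ᵥ u)) := by
    rw [← hGs, ← mulVec_dotProduct_eq, hGV, mulVec_dotProduct_eq, transpose_transpose,
      mulVec_dotProduct_eq, hKs]
  have h2 : u ⬝ᵥ (S.controlWeight k *ᵥ (S.V k *ᵥ x)) =
      (S.B k *ᵥ u) ⬝ᵥ (S.K (k + 1) *ᵥ (S.A k *ᵥ x)) := by
    rw [hGV, mulVec_dotProduct_eq]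
  have h3 : u ⬝ᵥ (S.controlWeight k *ᵥ u) = u ⬝ᵥ (S.R k *ᵥ u) +
      (S.B k *ᵥ u) ⬝ᵥ (S.K (k + 1) *ᵥ (S.B k *ᵥ u)) := by
    rw [controlWeight, add_mulVec, dotProduct_add, mulVec_dotProduct_eq]
    simp only [mulVec_mulVec, Matrix.mul_assoc]
  have h4 : x ⬝ᵥ (S.L k *ᵥ x) = x ⬝ᵥ (S.Q k *ᵥ x) +
      (S.A k *ᵥ x) ⬝ᵥ (S.K (k + 1) *ᵥ (S.A k *ᵥ x)) := by
    rw [L, Lstep, add_mulVec, dotProduct_add, mulVec_dotProduct_eq]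
    simp only [mulVec_mulVec, Matrix.mul_assoc]
  simp only [mulVec_add, dotProduct_add, add_dotProduct, h1, h2, h3, h4,
    dotProduct_Lam hK hG]
  ring

/-- When M divides k, write K_k = (L_k - Λ_k) + (1 - p) Λ_k. The form of L_k - Λ_k at x is the stage
cost under u = -V_k x, which makes the completed square vanish, so it is nonnegative.
Semidefiniteness of K_{k+1} is what makes `controlWeight` positive definite at each stage. -/
theorem posSemidef_K (hS : S.IsValid) {k : ℕ} (hk : k ≤ S.N) : (S.K k).PosSemidef := by
  induction hk using Nat.decreasingInduction with
  | self => rw [K_N]; exact hS.posSemidef_Q _ le_rfl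
  | of_succ k hk ih =>
    have hG := posDef_controlWeight hS hk ih
    have hL : (S.L k).PosSemidef := by
      have := ih.conjTranspose_mul_mul_same (S.A k)
      rw [conjTranspose_eq_transpose_of_trivial] at this
      exact (hS.posSemidef_Q k hk.le).add this
    rw [K_of_lt _ _ hk]
    split_ifs with hd
    · have hΛ := posSemidef_Lam ih.1 hG
      refine .of_dotProduct_mulVec_nonneg (hL.1.sub (hΛ.1.smul (by simp [IsSelfAdjoint])))
        fun x => ?_
      have h := stage_cost_eq ih.1 hG x (-(S.V k *ᵥ x))
      have h1 := (hS.posSemidef_Q k hk.le).dotProduct_mulVec_nonneg x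
      have h2 := (hS.posDef_R k hk).posSemidef.dotProduct_mulVec_nonneg (-(S.V k *ᵥ x))
      have h3 := ih.dotProduct_mulVec_nonneg (S.A k *ᵥ x + S.B k *ᵥ (-(S.V k *ᵥ x)))
      have h4 := hΛ.dotProduct_mulVec_nonneg x
      simp only [star_trivial] at h1 h2 h3 h4 ⊢
      have h5 := mul_nonneg (sub_nonneg.mpr hS.p_mem.2) h4
      simp only [neg_add_cancel, zero_dotProduct, sub_mulVec, dotProduct_sub, smul_mulVec,
        dotProduct_smul, smul_eq_mul] at h ⊢
      linarith
    · exact hL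

theorem posDef_controlWeight' (hS : S.IsValid) {k : ℕ} (hk : k < S.N) :
    (S.controlWeight k).PosDef :=
  posDef_controlWeight hS hk (posSemidef_K hS hk)

end FogSystem
end

/-! ### Independence and the σ-algebras generated by the noise. -/

noncomputable section

/-- If `m₁` is independent of `m₂`, and `m₁ ⊔ m₂` of `m₃`, then `m₁` is independent of
`m₂ ⊔ m₃`. -/
theorem ProbabilityTheory.Indep.sup_right_of_sup_left {Ω : Type*}
    {m₁ m₂ m₃ m : MeasurableSpace Ω} {μ : Measure Ω} [IsProbabilityMeasure μ]
    (h₁ : m₁ ≤ m) (h₂ : m₂ ≤ m) (h₃ : m₃ ≤ m) (h₁₂ : Indep m₁ m₂ μ)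
    (h₁₂₃ : Indep (m₁ ⊔ m₂) m₃ μ) : Indep m₁ (m₂ ⊔ m₃) μ := by
  -- The sets s ∩ t form a π-system generating `m₂ ⊔ m₃`. On them P(a ∩ s ∩ t) = P(a ∩ s) P(t) =
  -- P(a) P(s) P(t) = P(a) P(s ∩ t).
  refine IndepSets.indep (p1 := {s | MeasurableSet[m₁] s})
    (p2 := {u | ∃ s t, MeasurableSet[m₂] s ∧ MeasurableSet[m₃] t ∧ u = s ∩ t})
    h₁ (sup_le h₂ h₃) (@MeasurableSpace.isPiSystem_measurableSet Ω m₁) ?_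
    (@MeasurableSpace.generateFrom_measurableSet Ω m₁).symm ?_ ?_
  · rintro _ ⟨s, t, hs, ht, rfl⟩ _ ⟨s', t', hs', ht', rfl⟩ -
    exact ⟨s ∩ s', t ∩ t', @MeasurableSet.inter _ m₂ _ _ hs hs',
      @MeasurableSet.inter _ m₃ _ _ ht ht', by rw [Set.inter_inter_inter_comm]⟩
  · apply le_antisymm
    · refine sup_le (fun s hs => ?_) (fun t ht => ?_)
      · exact MeasurableSpace.measurableSet_generateFrom
          ⟨s, Set.univ, hs, @MeasurableSet.univ _ m₃, by simp⟩
      · exact MeasurableSpace.measurableSet_generateFrom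
          ⟨Set.univ, t, @MeasurableSet.univ _ m₂, ht, by simp⟩
    · refine MeasurableSpace.generateFrom_le ?_
      rintro _ ⟨s, t, hs, ht, rfl⟩
      exact @MeasurableSet.inter _ (m₂ ⊔ m₃) _ _ (le_sup_left (a := m₂) (b := m₃) s hs)
        (le_sup_right (a := m₂) (b := m₃) t ht)
  · rw [IndepSets_iff]
    rintro a _ ha ⟨s, t, hs, ht, rfl⟩
    rw [Indep_iff] at h₁₂ h₁₂₃
    have e₁ := h₁₂₃ (a ∩ s) t (@MeasurableSet.inter _ (m₁ ⊔ m₂) _ _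
      (le_sup_left (a := m₁) (b := m₂) a ha) (le_sup_right (a := m₁) (b := m₂) s hs)) ht
    have e₂ := h₁₂₃ s t (le_sup_right (a := m₁) (b := m₂) s hs) ht
    rw [← Set.inter_assoc, e₁, e₂, h₁₂ a s ha hs, mul_assoc]

namespace FogSystem

variable {n s : ℕ} {S : FogSystem n s} {Ω : Type*}

/-- The σ-algebra generated by the first `a` disturbances and the first `b` ON/OFF states. -/
@[reducible]
def noiseSigma (w : ℕ → Ω → Fin n → ℝ) (τ : ℕ → Ω → Bool) (a b : ℕ) : MeasurableSpace Ω :=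
  (⨆ i : Fin a, MeasurableSpace.comap (w i) inferInstance) ⊔
    ⨆ j : Fin b, MeasurableSpace.comap (τ j) inferInstance

section noiseSigma

variable {w : ℕ → Ω → Fin n → ℝ} {τ : ℕ → Ω → Bool}

theorem noiseSigma_mono {a a' b b' : ℕ} (ha : a ≤ a') (hb : b ≤ b') :
    noiseSigma w τ a b ≤ noiseSigma w τ a' b' := by
  refine sup_le_sup (iSup_le fun i => ?_) (iSup_le fun j => ?_)
  · exact le_iSup (fun i : Fin a' => MeasurableSpace.comap (w i) inferInstance)
      ⟨i, i.2.trans_le ha⟩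
  · exact le_iSup (fun i : Fin b' => MeasurableSpace.comap (τ i) inferInstance)
      ⟨j, j.2.trans_le hb⟩

theorem measurable_w_noiseSigma {a b i : ℕ} (h : i < a) : Measurable[noiseSigma w τ a b] (w i) :=
  (comap_measurable (w i)).mono ((le_iSup (fun i : Fin a =>
    MeasurableSpace.comap (w i) inferInstance) ⟨i, h⟩).trans le_sup_left) le_rfl

theorem measurable_τ_noiseSigma {a b j : ℕ} (h : j < b) : Measurable[noiseSigma w τ a b] (τ j) :=
  (comap_measurable (τ j)).mono ((le_iSup (fun i : Fin b =>
    MeasurableSpace.comap (τ i) inferInstance) ⟨j, h⟩).trans le_sup_right) le_rfl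

theorem comap_w_sup_eq (a : ℕ) : (⨆ i : Fin a, MeasurableSpace.comap (w i) inferInstance) =
    MeasurableSpace.comap (fun ω (i : Fin a) => w i ω) inferInstance := by
  simp only [MeasurableSpace.pi, MeasurableSpace.comap_iSup, MeasurableSpace.comap_comp]
  rfl

theorem comap_τ_sup_eq (a : ℕ) : (⨆ i : Fin a, MeasurableSpace.comap (τ i) inferInstance) =
    MeasurableSpace.comap (fun ω (i : Fin a) => τ i ω) inferInstance := by
  simp only [MeasurableSpace.pi, MeasurableSpace.comap_iSup, MeasurableSpace.comap_comp]
  rfl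

end noiseSigma

/-! ### What the state and the control can depend on. -/

section processes

variable {w : ℕ → Ω → Fin n → ℝ} {τ : ℕ → Ω → Bool} {x₀ : Fin n → ℝ} {π : FogPolicy n s}

theorem stateProc_succ (k : ℕ) (ω : Ω) :
    S.stateProc w τ x₀ π (k + 1) ω =
      S.A k *ᵥ S.stateProc w τ x₀ π k ω + S.B k *ᵥ S.controlProc w τ x₀ π k ω + w k ω :=
  S.state_succ π x₀ _ _ k

theorem controlProc_eq_zero (hπ : S.IsFeasible π) {k : ℕ} (hk : k < S.N)
    (h : ¬ (0 < k ∧ S.M ∣ k)) (ω : Ω) : S.controlProc w τ x₀ π k ω = 0 := by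
  rw [controlProc, control_eq, hπ.eq_zero_of_no_arrival k hk h]

theorem controlProc_eq_zero_of_off (hπ : S.IsFeasible π) {k : ℕ} (hk : k < S.N) {ω : Ω}
    (h : τ (k - S.MB) ω = false) : S.controlProc w τ x₀ π k ω = 0 := by
  rw [controlProc, control_eq, h, hπ.eq_zero_of_off k hk]

/-- The control at time `k` depends only on the disturbances before time `k - M` and the ON/OFF
states up to time `k - MB`; the state at time `k` only on the disturbances before time `k` and the
ON/OFF states before time `k - MB`. -/
theorem measurable_state_and_control (hπ : S.IsFeasible π) (hM : 1 ≤ S.M) (k : ℕ) :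
    (k ≤ S.N → Measurable[noiseSigma w τ k (k - S.MB)] (S.stateProc w τ x₀ π k)) ∧
    (k < S.N → Measurable[noiseSigma w τ (k - S.M) (k - S.MB + 1)]
      (S.controlProc w τ x₀ π k)) := by
  have hMB : S.MB ≤ S.M := Nat.le_add_left _ _
  have hMF : S.MF + S.MB = S.M := rfl
  induction k using Nat.strong_induction_on with
  | _ k ih =>
    constructor
    · intro hk
      cases k with
      | zero => exact @measurable_const _ _ _ (noiseSigma w τ 0 _) x₀
      | succ k =>
        obtain ⟨hx, hu⟩ := ih k (by omega)
        let _ : MeasurableSpace Ω := noiseSigma w τ (k + 1) (k + 1 - S.MB)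
        have hx' : Measurable (S.stateProc w τ x₀ π k) :=
          (hx (by omega)).mono (noiseSigma_mono (by omega) (by omega)) le_rfl
        have hu' : Measurable (S.controlProc w τ x₀ π k) := by
          -- With truncated subtraction, k - MB + 1 equals k + 1 - MB only if MB ≤ k. This holds at
          -- an arrival time, where k ≥ M; at other times the control is the constant 0.
          by_cases h : 0 < k ∧ S.M ∣ k
          · have := Nat.le_of_dvd h.1 h.2
            exact (hu (by omega)).mono (noiseSigma_mono (by omega) (by omega)) le_rfl
          · have : S.controlProc w τ x₀ π k = fun _ => 0 :=
              funext fun ω => controlProc_eq_zero hπ (by omega) h ω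
            rw [this]; exact measurable_const
        have hw : Measurable (w k) := measurable_w_noiseSigma (by omega)
        have : S.stateProc w τ x₀ π (k + 1) = fun ω => S.A k *ᵥ S.stateProc w τ x₀ π k ω +
            S.B k *ᵥ S.controlProc w τ x₀ π k ω + w k ω := funext fun ω => stateProc_succ k ω
        rw [this]
        have hmv : ∀ {m l : ℕ} (X : Matrix (Fin m) (Fin l) ℝ), Measurable fun v => X *ᵥ v :=
          fun X => (Continuous.matrix_mulVec continuous_const continuous_id).measurable
        exact (((hmv _).comp hx').add ((hmv _).comp hu')).add hw
    · intro hk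
      let _ : MeasurableSpace Ω := noiseSigma w τ (k - S.M) (k - S.MB + 1)
      by_cases h : 0 < k ∧ S.M ∣ k
      · have hMk := Nat.le_of_dvd h.1 h.2
        have hτ : Measurable (τ (k - S.MB)) := measurable_τ_noiseSigma (by omega)
        have hh : Measurable fun ω => S.history (fun i => S.stateProc w τ x₀ π i ω)
            (fun i => S.controlProc w τ x₀ π i ω) (fun i => τ i ω) k := by
          refine Measurable.prodMk (measurable_pi_lambda _ fun i => ?_)
            (measurable_pi_lambda _ fun i => ?_)
          · by_cases hi : i + S.M ≤ k
            · have hx : Measurable (S.stateProc w τ x₀ π i) :=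
                ((ih i (by omega)).1 (by omega)).mono (noiseSigma_mono (by omega) (by omega)) le_rfl
              have hτi : Measurable (τ (i + S.MF)) := measurable_τ_noiseSigma (by omega)
              simp only [hi, true_and]
              exact Measurable.ite (hτi (measurableSet_singleton true))
                (measurable_const.prodMk hx) measurable_const
            · simp only [hi, false_and, if_false]; exact measurable_const
          · by_cases hi : i < k
            · simp only [hi, if_true]
              by_cases h' : 0 < i ∧ S.M ∣ i
              · have hd : S.M ≤ k - i := Nat.le_of_dvd (by omega) (Nat.dvd_sub h.2 h'.2)
                exact ((ih i (by omega)).2 (by omega)).mono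
                  (noiseSigma_mono (by omega) (by omega)) le_rfl
              · simp only [controlProc_eq_zero hπ (hi.trans hk) h']; exact measurable_const
            · simp only [hi, if_false]; exact measurable_const
        have : S.controlProc w τ x₀ π k = fun ω => π k
            (S.history (fun i => S.stateProc w τ x₀ π i ω)
              (fun i => S.controlProc w τ x₀ π i ω) (fun i => τ i ω) k) (τ (k - S.MB) ω) :=
          funext fun ω => S.control_eq π x₀ _ _ k
        rw [this]
        exact (hπ.measurable k hk).comp (hh.prodMk hτ)
      · have : S.controlProc w τ x₀ π k = fun _ => 0 :=
          funext fun ω => controlProc_eq_zero hπ hk h ω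
        rw [this]; exact measurable_const

end processes

/-! ### Independence of the disturbances and of the ON/OFF states. -/

section independence

variable [mΩ : MeasurableSpace Ω] {μ : Measure Ω} {w : ℕ → Ω → Fin n → ℝ} {τ : ℕ → Ω → Bool}
  {τ₀ : Bool}

theorem IsNoiseModel.noiseSigma_le (h : S.IsNoiseModel μ w τ τ₀) {a b : ℕ} (ha : a ≤ S.N)
    (hb : b ≤ S.N) : noiseSigma w τ a b ≤ mΩ :=
  sup_le (iSup_le fun i => (h.measurable_w i (i.2.trans_le ha)).comap_le)
    (iSup_le fun i => (h.measurable_τ i (i.2.trans_le hb)).comap_le)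

/-- The two rows of the transition matrix agree, so the chain forgets its present state. This is
where p = 1 - q enters. -/
theorem onOffTransition_of_eq {p q : ℝ} (hpq : p = 1 - q) (b c : Bool) :
    onOffTransition p q b c = if c then p else 1 - p := by
  cases b <;> cases c <;> simp [onOffTransition] <;> linarith

theorem IsNoiseModel.measureReal_cylinder (h : S.IsNoiseModel μ w τ τ₀) (hpq : S.p = 1 - S.q)
    {j : ℕ} (hj : j + 1 < S.N) (b : Fin (j + 1) → Bool) (c : Bool) :
    μ.real {ω | τ (j + 1) ω = c ∧ (fun i : Fin (j + 1) => τ i ω) = b} =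
      (if c then S.p else 1 - S.p) * μ.real {ω | (fun i : Fin (j + 1) => τ i ω) = b} := by
  -- The Markov property is stated for infinite sequences; only the entries up to j + 1 matter, so
  -- the past b is continued by the constant c.
  have hm := h.markov_τ j hj (fun i => if hi : i < j + 1 then b ⟨i, hi⟩ else c)
  rw [onOffTransition_of_eq hpq] at hm
  have e1 : {ω | ∀ i ≤ j + 1, τ i ω = if hi : i < j + 1 then b ⟨i, hi⟩ else c} =
      {ω | τ (j + 1) ω = c ∧ (fun i : Fin (j + 1) => τ i ω) = b} := by
    ext ω
    simp only [Set.mem_ofPred_eq, funext_iff]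
    constructor
    · intro hω
      exact ⟨by simpa using hω (j + 1) le_rfl, fun i => (hω i (by omega)).trans (dif_pos i.2)⟩
    · rintro ⟨h1, h2⟩ i hi
      split_ifs with h3
      · exact h2 ⟨i, h3⟩
      · obtain rfl : i = j + 1 := by omega
        exact h1
  have e2 : {ω | ∀ i ≤ j, τ i ω = if hi : i < j + 1 then b ⟨i, hi⟩ else c} =
      {ω | (fun i : Fin (j + 1) => τ i ω) = b} := by
    ext ω
    simp only [Set.mem_ofPred_eq, funext_iff]
    constructor
    · intro hω i
      exact (hω i (by omega)).trans (dif_pos i.2)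
    · intro h2 i hi
      rw [dif_pos (by omega)]
      exact h2 ⟨i, by omega⟩
  rw [e1, e2] at hm
  rw [hm, mul_comm]
  simp

variable [IsProbabilityMeasure μ]

/-- The disturbance at time `i` is independent of the earlier ones and of the ON/OFF states. -/
theorem IsNoiseModel.indep_w_noiseSigma (h : S.IsNoiseModel μ w τ τ₀) {i : ℕ} (hi : i < S.N) :
    Indep (MeasurableSpace.comap (w i) inferInstance) (noiseSigma w τ i S.N) μ := by
  refine Indep.sup_right_of_sup_left (h.measurable_w i hi).comap_le
    (iSup_le fun j => (h.measurable_w j (j.2.trans hi)).comap_le)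
    (iSup_le fun j => (h.measurable_τ j j.2).comap_le) ?_ ?_
  · have h1 := indep_iSup_of_disjoint (fun j : Fin S.N => (h.measurable_w j j.2).comap_le)
      h.indep_w.iIndep (S := {⟨i, hi⟩}) (T := {j | (j : ℕ) < i}) (by simp)
    refine indep_of_indep_of_le_left (indep_of_indep_of_le_right h1 ?_) ?_
    · refine iSup_le fun j => ?_
      exact le_iSup₂_of_le (⟨j, j.2.trans hi⟩ : Fin S.N) j.2 le_rfl
    · exact le_iSup₂_of_le (⟨i, hi⟩ : Fin S.N) rfl le_rfl
  · have h2 := (IndepFun_iff_Indep _ _ _).mp h.indep_w_τ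
    rw [comap_τ_sup_eq]
    refine indep_of_indep_of_le_left h2 ?_
    rw [← comap_w_sup_eq]
    refine sup_le ?_ (iSup_le fun j => ?_)
    · exact le_iSup (fun i : Fin S.N => MeasurableSpace.comap (w i) inferInstance) ⟨i, hi⟩
    · exact le_iSup (fun i : Fin S.N => MeasurableSpace.comap (w i) inferInstance)
        ⟨j, j.2.trans hi⟩

/-- Sum the cylinder formula over the finitely many pasts. The time must be positive, since τ 0 has
a deterministic value. -/
theorem IsNoiseModel.measureReal_τ (h : S.IsNoiseModel μ w τ τ₀) (hpq : S.p = 1 - S.q)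
    {j : ℕ} (hj : j + 1 < S.N) (c : Bool) :
    μ.real {ω | τ (j + 1) ω = c} = if c then S.p else 1 - S.p := by
  have hpast : Measurable fun ω (i : Fin (j + 1)) => τ i ω :=
    measurable_pi_lambda _ fun i => h.measurable_τ i (by omega)
  have hsum : ∀ s : Set Ω, MeasurableSet s →
      μ.real s = ∑ b : Fin (j + 1) → Bool, μ.real (s ∩ {ω | (fun i : Fin (j + 1) => τ i ω) = b}) := by
    intro s hs
    rw [← measureReal_biUnion_finset]
    · congr 1; ext ω; simp
    · intro b _ b' _ hbb'
      refine Set.disjoint_left.mpr ?_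
      rintro ω ⟨_, h1⟩ ⟨_, h2⟩
      exact hbb' (h1.symm.trans h2)
    · intro b _
      exact hs.inter (hpast (measurableSet_singleton b))
  have hms : MeasurableSet {ω | τ (j + 1) ω = c} := h.measurable_τ _ hj (measurableSet_singleton c)
  have h1 := hsum Set.univ MeasurableSet.univ
  rw [hsum _ hms]
  simp only [probReal_univ, Set.univ_inter] at h1
  have : ∀ b, μ.real ({ω | τ (j + 1) ω = c} ∩ {ω | (fun i : Fin (j + 1) => τ i ω) = b}) =
    (if c then S.p else 1 - S.p) * μ.real {ω | (fun i : Fin (j + 1) => τ i ω) = b} :=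
    fun b => h.measureReal_cylinder hpq hj b c
  simp only [this, ← Finset.mul_sum, ← h1, mul_one]

/-- When `p = 1 - q`, the ON/OFF state at a positive time is independent of the earlier ones and of
the disturbances. -/
theorem IsNoiseModel.indep_τ_noiseSigma (h : S.IsNoiseModel μ w τ τ₀) (hpq : S.p = 1 - S.q)
    {j : ℕ} (hj0 : 0 < j) (hj : j < S.N) :
    Indep (MeasurableSpace.comap (τ j) inferInstance) (noiseSigma w τ S.N j) μ := by
  obtain ⟨j, rfl⟩ : ∃ i, j = i + 1 := ⟨j - 1, by omega⟩
  -- The ON/OFF past is adjoined first and the disturbances second, because the disturbances are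
  -- independent of all ON/OFF states jointly.
  rw [noiseSigma, sup_comm]
  refine Indep.sup_right_of_sup_left (h.measurable_τ _ hj).comap_le
    (iSup_le fun i => (h.measurable_τ i (i.2.trans hj)).comap_le)
    (iSup_le fun i => (h.measurable_w i i.2).comap_le) ?_ ?_
  · rw [comap_τ_sup_eq, ← IndepFun_iff_Indep]
    have hpast : Measurable fun ω (i : Fin (j + 1)) => τ i ω :=
      measurable_pi_lambda _ fun i => h.measurable_τ i (by omega)
    have hτ := h.measurable_τ _ hj
    -- Both variables take finitely many values, so the joint law need only be compared on
    -- singletons, where the cylinder formula applies.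
    rw [indepFun_iff_map_prod_eq_prod_map_map hτ.aemeasurable hpast.aemeasurable,
      Measure.ext_iff_singleton]
    rintro ⟨c, b⟩
    have hcb := h.measureReal_cylinder hpq hj b c
    rw [← h.measureReal_τ hpq hj c] at hcb
    rw [← Set.singleton_prod_singleton, Measure.prod_prod, Set.singleton_prod_singleton,
      Measure.map_apply (hτ.prodMk hpast) (measurableSet_singleton _),
      Measure.map_apply hτ (measurableSet_singleton _),
      Measure.map_apply hpast (measurableSet_singleton _),
      ← ENNReal.toReal_eq_toReal_iff' (measure_ne_top _ _)
        (ENNReal.mul_ne_top (measure_ne_top _ _) (measure_ne_top _ _)), ENNReal.toReal_mul]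
    have e : (fun ω => (τ (j + 1) ω, fun i : Fin (j + 1) => τ i ω)) ⁻¹' {(c, b)} =
        {ω | τ (j + 1) ω = c ∧ (fun i : Fin (j + 1) => τ i ω) = b} := by
      ext ω
      simp
    rw [e]
    exact hcb
  · have h2 := ((IndepFun_iff_Indep _ _ _).mp h.indep_w_τ).symm
    rw [comap_w_sup_eq]
    refine indep_of_indep_of_le_left h2 ?_
    rw [← comap_τ_sup_eq]
    refine sup_le ?_ (iSup_le fun i => ?_)
    · exact le_iSup (fun i : Fin S.N => MeasurableSpace.comap (τ i) inferInstance) ⟨j + 1, hj⟩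
    · exact le_iSup (fun i : Fin S.N => MeasurableSpace.comap (τ i) inferInstance)
        ⟨i, i.2.trans hj⟩

end independence

end FogSystem
end

/-! ### Square integrability, the linear predictor and its error. -/

noncomputable section

section memLp

variable {Ω : Type*} [MeasurableSpace Ω] {μ : Measure Ω} {l m : ℕ}

theorem MeasureTheory.MemLp.matrix_mulVec {f : Ω → Fin m → ℝ} (hf : MemLp f 2 μ)
    (X : Matrix (Fin l) (Fin m) ℝ) : MemLp (fun ω => X *ᵥ f ω) 2 μ :=
  (Matrix.mulVecLin X).toContinuousLinearMap.comp_memLp' hf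

theorem MeasureTheory.MemLp.integrable_dotProduct {f g : Ω → Fin m → ℝ} (hf : MemLp f 2 μ)
    (hg : MemLp g 2 μ) : Integrable (fun ω => f ω ⬝ᵥ g ω) μ :=
  integrable_finsetSum _ fun i _ => (hf.eval i).integrable_mul (hg.eval i)

theorem Matrix.measurable_mulVec (X : Matrix (Fin l) (Fin m) ℝ) : Measurable fun v => X *ᵥ v :=
  (Continuous.matrix_mulVec continuous_const continuous_id).measurable

theorem Matrix.measurable_quadratic (X : Matrix (Fin m) (Fin m) ℝ) :
    Measurable fun v : Fin m → ℝ => v ⬝ᵥ (X *ᵥ v) := by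
  have : Continuous fun v : Fin m → ℝ => v ⬝ᵥ (X *ᵥ v) := by
    simp only [dotProduct, mulVec]; fun_prop
  exact this.measurable

theorem MeasureTheory.integrable_quadratic {f : Ω → Fin m → ℝ} (hf : MemLp f 2 μ)
    (X : Matrix (Fin m) (Fin m) ℝ) : Integrable (fun ω => f ω ⬝ᵥ (X *ᵥ f ω)) μ :=
  hf.integrable_dotProduct (hf.matrix_mulVec X)

end memLp

namespace FogSystem

variable {n s : ℕ} {S : FogSystem n s} {Ω : Type*}

variable (S) in
/-- The error after `j` steps of the linear predictor started at time `i`. -/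
def predictError (w : ℕ → Ω → Fin n → ℝ) (i : ℕ) : ℕ → Ω → Fin n → ℝ
  | 0 => fun _ => 0
  | j + 1 => fun ω => S.A (i + j) *ᵥ predictError w i j ω + w (i + j) ω

theorem measurable_predictError {w : ℕ → Ω → Fin n → ℝ} {τ : ℕ → Ω → Bool} (i j b : ℕ) :
    Measurable[noiseSigma w τ (i + j) b] (S.predictError w i j) := by
  induction j with
  | zero => exact @measurable_const _ _ _ (noiseSigma w τ _ _) _
  | succ j ih =>
    let _ : MeasurableSpace Ω := noiseSigma w τ (i + (j + 1)) b
    have h1 : Measurable (S.predictError w i j) :=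
      ih.mono (noiseSigma_mono (by omega) le_rfl) le_rfl
    have h2 : Measurable (w (i + j)) := measurable_w_noiseSigma (by omega)
    exact ((measurable_mulVec _).comp h1).add h2

/-- Arrival times are M apart, so within a block starting at a multiple i of M only the control u_i
acts. Linearity then separates it from the disturbances. -/
theorem stateProc_add {w : ℕ → Ω → Fin n → ℝ} {τ : ℕ → Ω → Bool} {x₀ : Fin n → ℝ}
    {π : FogPolicy n s} (hπ : S.IsFeasible π) {i : ℕ} (hi : S.M ∣ i) {j : ℕ} (hj : j ≤ S.M)
    (hN : i + j ≤ S.N) (ω : Ω) :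
    S.stateProc w τ x₀ π (i + j) ω =
      S.predict i (S.stateProc w τ x₀ π i ω) (S.controlProc w τ x₀ π i ω) j +
        S.predictError w i j ω := by
  induction j with
  | zero => simp [predict, predictError]
  | succ j ih =>
    rw [← add_assoc, stateProc_succ, ih (by omega) (by omega), predict, predictError]
    by_cases h0 : j = 0
    · subst h0
      simp [predictError]
    · rw [controlProc_eq_zero (k := i + j) hπ (by omega)]
      · simp only [h0, if_false, mulVec_zero, mulVec_add, add_zero, add_assoc]
      · rintro ⟨-, h⟩
        have := Nat.le_of_dvd (by omega) ((Nat.dvd_add_right hi).mp h)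
        omega

theorem measurable_predict (i j : ℕ) :
    Measurable fun lam : (Fin n → ℝ) × (Fin s → ℝ) => S.predict i lam.1 lam.2 j := by
  induction j with
  | zero => exact measurable_fst
  | succ j ih =>
    refine ((measurable_mulVec _).comp ih).add ((measurable_mulVec _).comp ?_)
    split_ifs
    · exact measurable_snd
    · exact measurable_const

theorem measurable_optLaw (k : ℕ) : Measurable
    fun h : ((Fin n → ℝ) × (Fin s → ℝ)) × Bool => S.optLaw k h.1 h.2 := by
  by_cases hk : 0 < k ∧ S.M ∣ k
  · simp only [optLaw, hk.1, hk.2, true_and]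
    refine Measurable.ite (measurable_snd (measurableSet_singleton true)) ?_ measurable_const
    exact (((measurable_mulVec _).comp (measurable_predict _ _)).comp measurable_fst).neg
  · have : ∀ h : ((Fin n → ℝ) × (Fin s → ℝ)) × Bool, S.optLaw k h.1 h.2 = 0 := by
      intro h
      rw [optLaw, if_neg]
      tauto
    simp only [this]
    exact measurable_const

/-! ### Moments of the disturbances and of the prediction error. -/

section expectation

variable [mΩ : MeasurableSpace Ω] {μ : Measure Ω} {w : ℕ → Ω → Fin n → ℝ}
  {τ : ℕ → Ω → Bool} {τ₀ : Bool}

theorem memLp_predict {x : Ω → Fin n → ℝ} {u : Ω → Fin s → ℝ} (hx : MemLp x 2 μ)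
    (hu : MemLp u 2 μ) (i j : ℕ) : MemLp (fun ω => S.predict i (x ω) (u ω) j) 2 μ := by
  induction j with
  | zero => exact hx
  | succ j ih =>
    refine (ih.matrix_mulVec _).add (MemLp.matrix_mulVec ?_ _)
    split_ifs
    · exact hu
    · exact MemLp.zero

theorem memLp_optLaw {x : Ω → Fin n → ℝ} {u : Ω → Fin s → ℝ} {t : Ω → Bool} (hx : MemLp x 2 μ)
    (hu : MemLp u 2 μ) (ht : Measurable t) (k : ℕ) :
    MemLp (fun ω => S.optLaw k (x ω, u ω) (t ω)) 2 μ := by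
  have h := ((memLp_predict (S := S) hx hu (k - S.M) S.M).matrix_mulVec (S.V k)).neg
  by_cases hk : 0 < k ∧ S.M ∣ k
  · refine h.mono ?_ (ae_of_all _ fun ω => ?_)
    · exact ((measurable_optLaw k).comp_aemeasurable
        ((hx.1.aemeasurable.prodMk hu.1.aemeasurable).prodMk
          ht.aemeasurable)).aestronglyMeasurable
    · simp only [optLaw, hk.1, hk.2, true_and]
      split_ifs
      · rfl
      · simp
  · have : ∀ ω, S.optLaw k (x ω, u ω) (t ω) = 0 := by
      intro ω
      rw [optLaw, if_neg]
      tauto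
    simp only [this]
    exact MemLp.zero

theorem IsNoiseModel.memLp_predictError (h : S.IsNoiseModel μ w τ τ₀) {i j : ℕ}
    (hij : i + j ≤ S.N) : MemLp (S.predictError w i j) 2 μ := by
  induction j with
  | zero => exact MemLp.zero
  | succ j ih => exact ((ih (by omega)).matrix_mulVec _).add (h.memLp_w _ (by omega))

theorem IsNoiseModel.memLp_stateProc [IsProbabilityMeasure μ] (h : S.IsNoiseModel μ w τ τ₀)
    {x₀ : Fin n → ℝ}
    {π : FogPolicy n s} {k : ℕ} (hk : k ≤ S.N)
    (hu : ∀ j < k, MemLp (S.controlProc w τ x₀ π j) 2 μ) : MemLp (S.stateProc w τ x₀ π k) 2 μ := by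
  induction k with
  | zero => exact memLp_const x₀
  | succ k ih =>
    have : S.stateProc w τ x₀ π (k + 1) = fun ω => S.A k *ᵥ S.stateProc w τ x₀ π k ω +
        S.B k *ᵥ S.controlProc w τ x₀ π k ω + w k ω := funext fun ω => stateProc_succ k ω
    rw [this]
    exact (((ih (by omega) fun j hj => hu j (by omega)).matrix_mulVec _).add
      ((hu k (by omega)).matrix_mulVec _)).add (h.memLp_w k hk)

theorem indepFun_of_indep {α β : Type*} [MeasurableSpace α] [MeasurableSpace β]
    {m₁ m₂ : MeasurableSpace Ω} (h : Indep m₁ m₂ μ) {f : Ω → α} {g : Ω → β}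
    (hf : Measurable[m₁] f) (hg : Measurable[m₂] g) : IndepFun f g μ :=
  (IndepFun_iff_Indep _ _ _).mpr
    (indep_of_indep_of_le_left (indep_of_indep_of_le_right h hg.comap_le) hf.comap_le)

variable [IsProbabilityMeasure μ]

theorem IsNoiseModel.integral_w_apply (h : S.IsNoiseModel μ w τ τ₀) {i : ℕ} (hi : i < S.N)
    (a : Fin n) : ∫ ω, w i ω a ∂μ = 0 := by
  rw [← eval_integral fun a => ((h.memLp_w i hi).eval a).integrable (by norm_num),
    h.mean_w i hi]
  rfl

theorem IsNoiseModel.integral_w_mul_w (h : S.IsNoiseModel μ w τ τ₀) {i : ℕ} (hi : i < S.N)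
    (a b : Fin n) : ∫ ω, w i ω a * w i ω b ∂μ = S.W i a b := by
  rw [← h.cov_w i hi a b, covariance]
  simp only [h.integral_w_apply hi, sub_zero]

theorem IsNoiseModel.integral_dotProduct_w (h : S.IsNoiseModel μ w τ τ₀) {i : ℕ} (hi : i < S.N)
    {F : Ω → Fin n → ℝ} (hFm : Measurable[noiseSigma w τ i S.N] F) (hF : MemLp F 2 μ) :
    ∫ ω, F ω ⬝ᵥ w i ω ∂μ = 0 := by
  simp only [dotProduct]
  have h_int : ∀ a, Integrable (fun ω => F ω a * w i ω a) μ := fun a =>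
    (hF.eval a).integrable_mul ((h.memLp_w i hi).eval a)
  rw [integral_finsetSum _ fun a _ => h_int a]
  refine Finset.sum_eq_zero fun a _ => ?_
  have hind : IndepFun (fun ω => F ω a) (fun ω => w i ω a) μ :=
    indepFun_of_indep (h.indep_w_noiseSigma hi).symm ((measurable_pi_apply a).comp hFm)
      ((measurable_pi_apply a).comp (comap_measurable (w i)))
  rw [hind.integral_fun_mul_eq_mul_integral (hF.eval a).1 ((h.memLp_w i hi).eval a).1,
    h.integral_w_apply hi, mul_zero]

theorem IsNoiseModel.integral_mul_quadratic_w (h : S.IsNoiseModel μ w τ τ₀) {i : ℕ}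
    (hi : i < S.N) {χ : Ω → ℝ} (hχm : Measurable[noiseSigma w τ i S.N] χ)
    (X : Matrix (Fin n) (Fin n) ℝ) :
    ∫ ω, χ ω * (w i ω ⬝ᵥ (X *ᵥ w i ω)) ∂μ = (∫ ω, χ ω ∂μ) * (X * S.W i).trace := by
  have hw := h.memLp_w i hi
  have hind : IndepFun χ (fun ω => w i ω ⬝ᵥ (X *ᵥ w i ω)) μ :=
    indepFun_of_indep (h.indep_w_noiseSigma hi).symm hχm
      ((measurable_quadratic X).comp (comap_measurable (w i)))
  rw [hind.integral_fun_mul_eq_mul_integral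
    (hχm.mono (h.noiseSigma_le hi.le le_rfl) le_rfl).aestronglyMeasurable
    (integrable_quadratic hw X).1]
  congr 1
  -- The trace pairs X a b with W b a, whereas the quadratic form produces the moment W a b.
  have hsym : ∀ a b, S.W i a b = S.W i b a := fun a b => by
    rw [← h.integral_w_mul_w hi, ← h.integral_w_mul_w hi]; simp only [mul_comm]
  simp only [dotProduct, mulVec, Matrix.trace, Matrix.diag, Matrix.mul_apply]
  have h_int : ∀ a b, Integrable (fun ω => w i ω a * (X a b * w i ω b)) μ := fun a b =>
    (hw.eval a).integrable_mul ((hw.eval b).const_mul (X a b))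
  simp only [Finset.mul_sum]
  rw [integral_finsetSum _ fun a _ => integrable_finsetSum _ fun b _ => h_int a b]
  refine Finset.sum_congr rfl fun a _ => ?_
  rw [integral_finsetSum _ fun b _ => h_int a b]
  refine Finset.sum_congr rfl fun b _ => ?_
  rw [hsym b a, ← h.integral_w_mul_w hi a b, ← integral_const_mul]
  congr 1
  ext ω
  ring

/-- A quadratic form of `y + w i`, with `y` independent of `w i`, has in expectation no cross
terms. -/
theorem IsNoiseModel.integral_mul_quadratic_add_w (h : S.IsNoiseModel μ w τ τ₀) {i : ℕ}
    (hi : i < S.N) {χ : Ω → ℝ} (hχm : Measurable[noiseSigma w τ i S.N] χ)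
    (hχ : ∀ ω, ‖χ ω‖ ≤ 1) {y : Ω → Fin n → ℝ} (hym : Measurable[noiseSigma w τ i S.N] y)
    (hy : MemLp y 2 μ) (X : Matrix (Fin n) (Fin n) ℝ) :
    ∫ ω, χ ω * ((y ω + w i ω) ⬝ᵥ (X *ᵥ (y ω + w i ω))) ∂μ =
      ∫ ω, χ ω * (y ω ⬝ᵥ (X *ᵥ y ω)) ∂μ + (∫ ω, χ ω ∂μ) * (X * S.W i).trace := by
  have hw := h.memLp_w i hi
  have hle := h.noiseSigma_le hi.le le_rfl
  have hχs : AEStronglyMeasurable χ μ := (hχm.mono hle le_rfl).aestronglyMeasurable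
  have h_int : ∀ {f : Ω → ℝ}, Integrable f μ → Integrable (fun ω => χ ω * f ω) μ := fun hf =>
    hf.bdd_mul hχs (ae_of_all _ hχ)
  -- The bounded factor χ is absorbed into the vector χ • Z y, which is again independent of w i. As
  -- X need not be symmetric, this is used both for X and for Xᵀ.
  have hcross : ∀ Z : Matrix (Fin n) (Fin n) ℝ, ∫ ω, χ ω * ((Z *ᵥ y ω) ⬝ᵥ w i ω) ∂μ = 0 := by
    intro Z
    have hF : MemLp (fun ω => χ ω • (Z *ᵥ y ω)) 2 μ := by
      refine (hy.matrix_mulVec Z).mono (hχs.smul (hy.matrix_mulVec Z).1)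
        (ae_of_all _ fun ω => ?_)
      rw [norm_smul]
      exact mul_le_of_le_one_left (norm_nonneg _) (hχ ω)
    have hFm : Measurable[noiseSigma w τ i S.N] fun ω => χ ω • (Z *ᵥ y ω) :=
      hχm.smul ((measurable_mulVec Z).comp hym)
    simpa [smul_dotProduct] using h.integral_dotProduct_w hi hFm hF
  have e : ∀ ω, χ ω * ((y ω + w i ω) ⬝ᵥ (X *ᵥ (y ω + w i ω))) =
      χ ω * (y ω ⬝ᵥ (X *ᵥ y ω)) + χ ω * (w i ω ⬝ᵥ (X *ᵥ w i ω)) +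
        (χ ω * ((X *ᵥ y ω) ⬝ᵥ w i ω) + χ ω * ((Xᵀ *ᵥ y ω) ⬝ᵥ w i ω)) := by
    intro ω
    rw [mulVec_dotProduct_eq Xᵀ, transpose_transpose, dotProduct_comm (X *ᵥ y ω)]
    simp only [mulVec_add, dotProduct_add, add_dotProduct]
    ring
  simp only [e]
  have i1 := h_int (integrable_quadratic hy X)
  have i2 := h_int (integrable_quadratic hw X)
  have i3 := h_int ((hy.matrix_mulVec X).integrable_dotProduct hw)
  have i4 := h_int ((hy.matrix_mulVec Xᵀ).integrable_dotProduct hw)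
  rw [integral_add (i1.fun_add i2) (i3.fun_add i4), integral_add i1 i2, integral_add i3 i4, hcross,
    hcross, h.integral_mul_quadratic_w hi hχm X]
  ring

/-- Peel off the last disturbance, which has mean zero and is independent of F, and move the matrix
A onto F by transposition. F may involve all ON/OFF states but only the disturbances before time i.
-/
theorem IsNoiseModel.integral_dotProduct_predictError (h : S.IsNoiseModel μ w τ τ₀) {i j : ℕ}
    (hij : i + j ≤ S.N) {F : Ω → Fin n → ℝ} (hFm : Measurable[noiseSigma w τ i S.N] F)
    (hF : MemLp F 2 μ) : ∫ ω, F ω ⬝ᵥ S.predictError w i j ω ∂μ = 0 := by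
  induction j generalizing F with
  | zero => simp [predictError]
  | succ j ih =>
    have hE := h.memLp_predictError (i := i) (j := j) (by omega)
    have e : ∀ ω, F ω ⬝ᵥ S.predictError w i (j + 1) ω =
        ((S.A (i + j))ᵀ *ᵥ F ω) ⬝ᵥ S.predictError w i j ω + F ω ⬝ᵥ w (i + j) ω := by
      intro ω
      rw [predictError, dotProduct_add, mulVec_dotProduct_eq, transpose_transpose]
    have hFm' : Measurable[noiseSigma w τ i S.N] fun ω => (S.A (i + j))ᵀ *ᵥ F ω :=
      (measurable_mulVec _).comp hFm
    simp only [e]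
    rw [integral_add ((hF.matrix_mulVec _).integrable_dotProduct hE)
      (hF.integrable_dotProduct (h.memLp_w _ (by omega))),
      ih (by omega) hFm' (hF.matrix_mulVec _),
      h.integral_dotProduct_w (by omega) (hFm.mono (noiseSigma_mono (by omega) le_rfl) le_rfl) hF,
      add_zero]

/-- The weighted second moment of the prediction error between consecutive multiples of `M`. -/
theorem IsNoiseModel.integral_mul_quadratic_predictError (h : S.IsNoiseModel μ w τ τ₀) {i j : ℕ}
    (hi : S.M ∣ i) (hj : j ≤ S.M) (hij : i + j ≤ S.N) (hc : i + j ≤ S.c * S.M)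
    {χ : Ω → ℝ} (hχm : Measurable[noiseSigma w τ i S.N] χ) (hχ : ∀ ω, ‖χ ω‖ ≤ 1) :
    ∫ ω, χ ω * (S.predictError w i j ω ⬝ᵥ (S.P (i + j) *ᵥ S.predictError w i j ω)) ∂μ =
      (∫ ω, χ ω ∂μ) * ∑ a ∈ Finset.range j, (S.P (i + a + 1) * S.W (i + a)).trace := by
  induction j with
  | zero => simp [predictError]
  | succ j ih =>
    have hE := h.memLp_predictError (i := i) (j := j) (by omega)
    have hEm : Measurable[noiseSigma w τ (i + j) S.N] (S.predictError w i j) :=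
      measurable_predictError i j S.N
    have hstep := h.integral_mul_quadratic_add_w (i := i + j) (by omega)
      (hχm.mono (noiseSigma_mono (by omega) le_rfl) le_rfl) hχ
      ((measurable_mulVec (S.A (i + j))).comp hEm) (hE.matrix_mulVec (S.A (i + j)))
      (S.P (i + j + 1))
    rw [Finset.sum_range_succ, mul_add, ← ih (by omega) (by omega) (by omega)]
    refine hstep.trans ?_
    congr 1
    congr 1
    ext ω
    -- At j = 0 the error vanishes, so the value of P at the multiple i of M is irrelevant. For j >
    -- 0 the time i + j is strictly inside a block, where P_{i+j} = Aᵀ P_{i+j+1} A.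
    rcases Nat.eq_zero_or_pos j with rfl | hj0
    · simp [predictError]
    · have hnd : ¬ S.M ∣ i + j := fun hd => by
        have := Nat.le_of_dvd hj0 ((Nat.dvd_add_right hi).mp hd)
        omega
      rw [S.P_of_lt (i + j) (by omega), if_neg hnd, Function.comp, mulVec_dotProduct_eq]
      simp only [mulVec_mulVec, Matrix.mul_assoc]

/-- Multiplying by the indicator of `τ j = true` multiplies the expectation of a quantity
determined by the earlier ON/OFF states and the disturbances by `p`. -/
theorem IsNoiseModel.integral_on_mul (h : S.IsNoiseModel μ w τ τ₀) (hpq : S.p = 1 - S.q)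
    {j : ℕ} (hj0 : 0 < j) (hj : j < S.N) {f : Ω → ℝ}
    (hf : Measurable[noiseSigma w τ S.N j] f) :
    ∫ ω, (if τ j ω = true then (1 : ℝ) else 0) * f ω ∂μ = S.p * ∫ ω, f ω ∂μ := by
  have hχ : Measurable fun b : Bool => if b = true then (1 : ℝ) else 0 := measurable_of_finite _
  have hind : IndepFun (fun ω => if τ j ω = true then (1 : ℝ) else 0) f μ :=
    indepFun_of_indep (h.indep_τ_noiseSigma hpq hj0 hj) (hχ.comp (comap_measurable (τ j))) hf
  rw [hind.integral_fun_mul_eq_mul_integral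
    (hχ.comp (h.measurable_τ j hj)).aestronglyMeasurable
    (hf.mono (h.noiseSigma_le le_rfl hj.le) le_rfl).aestronglyMeasurable]
  congr 1
  obtain ⟨j, rfl⟩ : ∃ i, j = i + 1 := ⟨j - 1, by omega⟩
  have := h.measureReal_τ hpq hj true
  simp only [if_true] at this
  have hms : MeasurableSet {ω | τ (j + 1) ω = true} :=
    h.measurable_τ _ hj (measurableSet_singleton true)
  rw [← this, ← integral_indicator_one hms]
  congr 1
  ext ω
  simp [Set.indicator]

end expectation

/-! ### Arrival times and feasible policies. -/

/-- Since 1 ≤ a ≤ M, the number c M is the largest multiple of M strictly below N. Hence the choice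
a = M, not 0, when M divides N. -/
theorem exists_N_eq_c_mul_M_add (hM : 1 ≤ S.M) (hMN : S.M ≤ S.N) :
    ∃ a, 1 ≤ a ∧ a ≤ S.M ∧ S.N = S.c * S.M + a := by
  unfold c
  split_ifs with hd
  · refine ⟨S.M, hM, le_rfl, ?_⟩
    rw [Nat.div_mul_cancel (Nat.dvd_sub hd dvd_rfl)]
    omega
  · refine ⟨S.N % S.M, Nat.pos_of_ne_zero fun h => hd (Nat.dvd_of_mod_eq_zero h),
      (Nat.mod_lt _ hM).le, ?_⟩
    rw [Nat.div_mul_cancel (Nat.dvd_sub_mod _)]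
    have := Nat.mod_le S.N S.M
    omega

theorem le_c_mul_M (hM : 1 ≤ S.M) (hMN : S.M ≤ S.N) {k : ℕ} (hk : k < S.N) (hd : S.M ∣ k) :
    k ≤ S.c * S.M := by
  obtain ⟨a, h1, h2, h3⟩ := exists_N_eq_c_mul_M_add hM hMN
  obtain ⟨m, rfl⟩ := hd
  have : m < S.c + 1 := by
    refine lt_of_mul_lt_mul_left (a := S.M) ?_ (Nat.zero_le _)
    nlinarith
  rw [mul_comm]
  exact Nat.mul_le_mul_right _ (by omega)

/-- Summing over the blocks of length `M` that end at the arrival times covers the times before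
`c M`. -/
theorem sum_arrivals_eq (hM : 1 ≤ S.M) (hMN : S.M ≤ S.N) (f : ℕ → ℝ) :
    (∑ k ∈ Finset.range S.N, if 0 < k ∧ S.M ∣ k then
      ∑ a ∈ Finset.range S.M, f (k - S.M + a) else 0) = ∑ i ∈ Finset.range (S.c * S.M), f i := by
  have hblock : ∀ c, ∑ i ∈ Finset.range (c * S.M), f i =
      ∑ m ∈ Finset.range c, ∑ a ∈ Finset.range S.M, f (m * S.M + a) := by
    intro c
    induction c with
    | zero => simp
    | succ c ih => rw [Nat.succ_mul, Finset.sum_range_add, ih, Finset.sum_range_succ]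
  obtain ⟨a, h1, h2, h3⟩ := exists_N_eq_c_mul_M_add hM hMN
  rw [hblock, ← Finset.sum_filter]
  symm
  -- Block m, which starts at m M, is matched with the arrival time (m + 1) M at its end.
  refine Finset.sum_nbij' (fun m => (m + 1) * S.M) (fun k => k / S.M - 1) ?_ ?_ ?_ ?_ ?_
  · intro m hm
    have hm' : m + 1 ≤ S.c := Finset.mem_range.mp hm
    have := Nat.mul_le_mul_right S.M hm'
    simp only [Finset.mem_filter, Finset.mem_range]
    exact ⟨by omega, by positivity, Dvd.intro_left _ rfl⟩
  · intro k hk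
    simp only [Finset.mem_filter, Finset.mem_range] at hk ⊢
    have hle := le_c_mul_M hM hMN hk.1 hk.2.2
    obtain ⟨m, rfl⟩ := hk.2.2
    rw [Nat.mul_div_cancel_left _ hM]
    rw [mul_comm] at hle
    have h4 := Nat.le_of_mul_le_mul_right hle hM
    have h5 : 0 < m := Nat.pos_of_mul_pos_left hk.2.1
    omega
  · intro m _
    simp only [Nat.mul_div_cancel _ (show 0 < S.M from hM), Nat.add_sub_cancel]
  · intro k hk
    simp only [Finset.mem_filter, Finset.mem_range] at hk ⊢
    obtain ⟨m, rfl⟩ := hk.2.2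
    have h5 : 0 < m := Nat.pos_of_mul_pos_left hk.2.1
    rw [Nat.mul_div_cancel_left _ hM, Nat.sub_add_cancel h5, mul_comm]
  · intro m _
    simp only [Nat.succ_mul, Nat.add_sub_cancel]

/-- The zero policy serves as the reference in which policy-independent quantities are expressed. -/
theorem isFeasible_zero : S.IsFeasible (fun _ _ _ => 0) where
  measurable _ _ := measurable_const
  eq_zero_of_no_arrival _ _ _ _ _ := rfl
  eq_zero_of_off _ _ _ := rfl

theorem isFeasible_optPolicy : S.IsFeasible S.optPolicy where
  measurable k _ := by
    have h : Measurable fun h : FogHistory n s × Bool =>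
        (((h.1.1 (k - S.M)).2, h.1.2 (k - S.M)), h.2) := by fun_prop
    exact (measurable_optLaw k).comp h
  eq_zero_of_no_arrival k _ h H t := by
    rw [optPolicy, optLaw, if_neg]
    tauto
  eq_zero_of_off k _ H := by simp [optPolicy, optLaw]

theorem optLaw_eq_zero {k : ℕ} (h : ¬ (0 < k ∧ S.M ∣ k)) (lam : (Fin n → ℝ) × (Fin s → ℝ))
    (t : Bool) : S.optLaw k lam t = 0 := by
  rw [optLaw, if_neg]
  tauto

theorem optLaw_off (k : ℕ) (lam : (Fin n → ℝ) × (Fin s → ℝ)) : S.optLaw k lam false = 0 := by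
  simp [optLaw]

/-- The measurement x_{k-M} reaches the controller at the very time when u_k is generated. Whenever
a nonzero control is allowed, this measurement has therefore been received. -/
theorem MF_add_eq_sub_MB {k : ℕ} (hk : S.M ≤ k) : k - S.M + S.MF = k - S.MB := by
  have hMF : S.MF + S.MB = S.M := rfl
  omega

/-! ### Deviation from the linear law, path by path. -/

section paths

variable {w : ℕ → Ω → Fin n → ℝ} {τ : ℕ → Ω → Bool} {x₀ : Fin n → ℝ} {π : FogPolicy n s}

theorem controlProc_optPolicy (hM : 1 ≤ S.M) (k : ℕ) (ω : Ω) :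
    S.controlProc w τ x₀ S.optPolicy k ω =
      S.optLaw k (S.stateProc w τ x₀ S.optPolicy (k - S.M) ω,
        S.controlProc w τ x₀ S.optPolicy (k - S.M) ω) (τ (k - S.MB) ω) := by
  by_cases h : 0 < k ∧ S.M ∣ k
  · have hMk := Nat.le_of_dvd h.1 h.2
    cases hτ : τ (k - S.MB) ω with
    | false => rw [optLaw_off, controlProc, control_eq, hτ, optPolicy, optLaw_off]
    | true =>
      rw [controlProc, control_eq, optPolicy, hτ]
      congr 2
      · rw [history]
        simp only [Nat.sub_add_cancel hMk, MF_add_eq_sub_MB hMk, hτ, le_refl, and_self, if_true]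
        rfl
      · rw [history]
        simp only [show k - S.M < k by omega, if_true]
        rfl
  · rw [optLaw_eq_zero h, controlProc, control_eq, optPolicy, optLaw_eq_zero h]

variable (S w τ x₀ π) in
/-- The difference between the control at time `k` and the one that the linear law would apply in
the same situation. -/
def deviation (k : ℕ) (ω : Ω) : Fin s → ℝ :=
  S.controlProc w τ x₀ π k ω - S.optLaw k (S.stateProc w τ x₀ π (k - S.M) ω,
    S.controlProc w τ x₀ π (k - S.M) ω) (τ (k - S.MB) ω)

theorem deviation_optPolicy (hM : 1 ≤ S.M) (k : ℕ) (ω : Ω) :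
    S.deviation w τ x₀ S.optPolicy k ω = 0 := by
  rw [deviation, ← controlProc_optPolicy hM, sub_self]

theorem deviation_eq_zero (hπ : S.IsFeasible π) {k : ℕ} (hk : k < S.N)
    (h : ¬ (0 < k ∧ S.M ∣ k)) (ω : Ω) : S.deviation w τ x₀ π k ω = 0 := by
  rw [deviation, controlProc_eq_zero hπ hk h, optLaw_eq_zero h, sub_zero]

/-- The deviation does not see the disturbances from time k - M on, hence is uncorrelated with the
prediction error over the last M steps. -/
theorem measurable_deviation (hπ : S.IsFeasible π) (hM : 1 ≤ S.M) {k : ℕ} (hk : k < S.N) :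
    Measurable[noiseSigma w τ (k - S.M) (k - S.MB + 1)] (S.deviation w τ x₀ π k) := by
  let _ : MeasurableSpace Ω := noiseSigma w τ (k - S.M) (k - S.MB + 1)
  have hu : Measurable (S.controlProc w τ x₀ π k) :=
    (measurable_state_and_control hπ hM k).2 hk
  have hx' : Measurable (S.stateProc w τ x₀ π (k - S.M)) :=
    ((measurable_state_and_control hπ hM (k - S.M)).1 (by omega)).mono
      (noiseSigma_mono (by omega) (by omega)) le_rfl
  have hu' : Measurable (S.controlProc w τ x₀ π (k - S.M)) :=
    ((measurable_state_and_control hπ hM (k - S.M)).2 (by omega)).mono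
      (noiseSigma_mono (by omega) (by omega)) le_rfl
  have hτ : Measurable (τ (k - S.MB)) := measurable_τ_noiseSigma (by omega)
  exact hu.sub ((measurable_optLaw k).comp ((hx'.prodMk hu').prodMk hτ))

/-- The one-step penalty in terms of the deviation from the linear law and the prediction error. -/
theorem penalty_eq (hS : S.IsValid) (hπ : S.IsFeasible π) {k : ℕ} (hk : k < S.N) (hk0 : 0 < k)
    (hd : S.M ∣ k) (ω : Ω) :
    (S.controlProc w τ x₀ π k ω + S.V k *ᵥ S.stateProc w τ x₀ π k ω) ⬝ᵥ
        (S.controlWeight k *ᵥ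
          (S.controlProc w τ x₀ π k ω + S.V k *ᵥ S.stateProc w τ x₀ π k ω)) =
      S.deviation w τ x₀ π k ω ⬝ᵥ (S.controlWeight k *ᵥ S.deviation w τ x₀ π k ω) +
      2 * (((S.controlWeight k * S.V k)ᵀ *ᵥ S.deviation w τ x₀ π k ω) ⬝ᵥ
        S.predictError w (k - S.M) S.M ω) +
      (if τ (k - S.MB) ω = true then (1 : ℝ) else 0) *
        (S.predictError w (k - S.M) S.M ω ⬝ᵥ (S.Lam k *ᵥ S.predictError w (k - S.M) S.M ω)) +
      (S.stateProc w τ x₀ π k ω ⬝ᵥ (S.Lam k *ᵥ S.stateProc w τ x₀ π k ω) -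
        (if τ (k - S.MB) ω = true then (1 : ℝ) else 0) *
          (S.stateProc w τ x₀ π k ω ⬝ᵥ (S.Lam k *ᵥ S.stateProc w τ x₀ π k ω))) := by
  have hMk := Nat.le_of_dvd hk0 hd
  have hK := (posSemidef_K hS (k := k + 1) hk).1
  have hG := posDef_controlWeight' hS hk
  have hGs := transpose_eq_of_isHermitian hG.1
  -- OFF: control and deviation vanish, and the penalty is the Λ_k form of the state. ON: the
  -- prediction cancels against the linear law, and u + V x becomes D + V e.
  cases hτ : τ (k - S.MB) ω with
  | false =>
    have hu := controlProc_eq_zero_of_off (w := w) (x₀ := x₀) hπ hk hτ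
    have hD : S.deviation w τ x₀ π k ω = 0 := by rw [deviation, hu, hτ, optLaw_off, sub_zero]
    rw [hu, hD]
    simp [dotProduct_Lam hK hG]
  | true =>
    have hx := stateProc_add (w := w) (τ := τ) (x₀ := x₀) hπ (Nat.dvd_sub hd dvd_rfl) le_rfl
      (by omega : k - S.M + S.M ≤ S.N) ω
    rw [Nat.sub_add_cancel hMk] at hx
    set D := S.deviation w τ x₀ π k ω with hD
    set e := S.predictError w (k - S.M) S.M ω
    have hsum : S.controlProc w τ x₀ π k ω + S.V k *ᵥ S.stateProc w τ x₀ π k ω =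
        D + S.V k *ᵥ e := by
      rw [hD, hx, deviation, hτ, optLaw, if_pos ⟨hk0, hd, rfl⟩, mulVec_add]
      abel
    have hsym : (S.V k *ᵥ e) ⬝ᵥ (S.controlWeight k *ᵥ D) =
        D ⬝ᵥ (S.controlWeight k *ᵥ (S.V k *ᵥ e)) := by
      rw [dotProduct_comm, mulVec_dotProduct_eq, hGs]
    have hcr : ((S.controlWeight k * S.V k)ᵀ *ᵥ D) ⬝ᵥ e =
        D ⬝ᵥ (S.controlWeight k *ᵥ (S.V k *ᵥ e)) := by
      rw [mulVec_dotProduct_eq, transpose_transpose, mulVec_mulVec]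
    rw [hsum, hcr, dotProduct_Lam hK hG e]
    simp only [mulVec_add, dotProduct_add, add_dotProduct, hsym, if_true]
    ring

end paths

/-! ### The expected cost as a constant plus deviation penalties. -/

section cost

variable [mΩ : MeasurableSpace Ω] {μ : Measure Ω} [IsProbabilityMeasure μ]
  {w : ℕ → Ω → Fin n → ℝ} {τ : ℕ → Ω → Bool} {τ₀ : Bool} {x₀ : Fin n → ℝ} {π : FogPolicy n s}

variable (S μ w τ x₀) in
/-- The policy-independent part of the expected penalty at an arrival time `k`: the effect of the
prediction error, and a correction for the case that the ON/OFF state at time `k - MB` is the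
deterministic initial one. -/
def penaltyConst (k : ℕ) : ℝ :=
  (∫ ω, (if τ (k - S.MB) ω = true then (1 : ℝ) else 0) ∂μ) *
      ∑ a ∈ Finset.range S.M, (S.P (k - S.M + a + 1) * S.W (k - S.M + a)).trace +
    (S.p * ∫ ω, S.stateProc w τ x₀ (fun _ _ _ => 0) k ω ⬝ᵥ
        (S.Lam k *ᵥ S.stateProc w τ x₀ (fun _ _ _ => 0) k ω) ∂μ -
      ∫ ω, (if τ (k - S.MB) ω = true then (1 : ℝ) else 0) *
        (S.stateProc w τ x₀ (fun _ _ _ => 0) k ω ⬝ᵥ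
          (S.Lam k *ᵥ S.stateProc w τ x₀ (fun _ _ _ => 0) k ω)) ∂μ)

/-- The state at time k involves only ON/OFF states before time k - MB, so it is independent of
τ_{k-MB} when that time is positive. -/
theorem IsNoiseModel.integral_on_mul_state (h : S.IsNoiseModel μ w τ τ₀)
    (hpq : S.p = 1 - S.q) (hM : 1 ≤ S.M) (hπ : S.IsFeasible π) {k : ℕ} (hk : k < S.N)
    (hk0 : 0 < k - S.MB) (X : Matrix (Fin n) (Fin n) ℝ) :
    ∫ ω, (if τ (k - S.MB) ω = true then (1 : ℝ) else 0) *
        (S.stateProc w τ x₀ π k ω ⬝ᵥ (X *ᵥ S.stateProc w τ x₀ π k ω)) ∂μ =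
      S.p * ∫ ω, S.stateProc w τ x₀ π k ω ⬝ᵥ (X *ᵥ S.stateProc w τ x₀ π k ω) ∂μ :=
  h.integral_on_mul hpq hk0 (by omega) ((measurable_quadratic X).comp
    (((measurable_state_and_control hπ hM k).1 hk.le).mono
      (noiseSigma_mono hk.le le_rfl) le_rfl))

/-- Both sides vanish by independence unless k - MB = 0, which forces MF = 0 and k = M. In that case
no control has acted before time M, so x_M is the same under every feasible policy. -/
theorem IsNoiseModel.off_correction_eq (h : S.IsNoiseModel μ w τ τ₀) (hpq : S.p = 1 - S.q)
    (hM : 1 ≤ S.M) (hπ : S.IsFeasible π) {k : ℕ} (hk : k < S.N) (hk0 : 0 < k) (hd : S.M ∣ k) :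
    S.p * ∫ ω, S.stateProc w τ x₀ π k ω ⬝ᵥ (S.Lam k *ᵥ S.stateProc w τ x₀ π k ω) ∂μ -
      ∫ ω, (if τ (k - S.MB) ω = true then (1 : ℝ) else 0) *
        (S.stateProc w τ x₀ π k ω ⬝ᵥ (S.Lam k *ᵥ S.stateProc w τ x₀ π k ω)) ∂μ =
    S.p * ∫ ω, S.stateProc w τ x₀ (fun _ _ _ => 0) k ω ⬝ᵥ
        (S.Lam k *ᵥ S.stateProc w τ x₀ (fun _ _ _ => 0) k ω) ∂μ -
      ∫ ω, (if τ (k - S.MB) ω = true then (1 : ℝ) else 0) *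
        (S.stateProc w τ x₀ (fun _ _ _ => 0) k ω ⬝ᵥ
          (S.Lam k *ᵥ S.stateProc w τ x₀ (fun _ _ _ => 0) k ω)) ∂μ := by
  rcases Nat.eq_zero_or_pos (k - S.MB) with h0 | h0
  · have hMk := Nat.le_of_dvd hk0 hd
    have hMB : S.MB ≤ S.M := Nat.le_add_left _ _
    obtain rfl : k = S.M := by omega
    have hx : ∀ {π' : FogPolicy n s}, S.IsFeasible π' → ∀ ω,
        S.stateProc w τ x₀ π' S.M ω = S.predict 0 x₀ 0 S.M + S.predictError w 0 S.M ω := by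
      intro π' hπ' ω
      have := stateProc_add (w := w) (τ := τ) (x₀ := x₀) hπ' (dvd_zero _) le_rfl
        (by omega : 0 + S.M ≤ S.N) ω
      rw [zero_add, controlProc_eq_zero hπ' (by omega) (by simp)] at this
      exact this
    simp only [hx hπ, hx isFeasible_zero]
  · rw [h.integral_on_mul_state hpq hM hπ hk h0,
      h.integral_on_mul_state hpq hM isFeasible_zero hk h0, sub_self, sub_self]

theorem memLp_deviation (h : S.IsNoiseModel μ w τ τ₀)
    (hu : ∀ k < S.N, MemLp (S.controlProc w τ x₀ π k) 2 μ) {k : ℕ} (hk : k < S.N) :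
    MemLp (S.deviation w τ x₀ π k) 2 μ :=
  (hu k hk).sub (memLp_optLaw (h.memLp_stateProc (by omega) fun j hj => hu j (by omega))
    (hu _ (by omega)) (h.measurable_τ _ (by omega)) k)

/-- Take expectations in `penalty_eq`: the cross term vanishes, and the error term gives the sum of
traces because P_k = Λ_k at arrival times. The term (1 - p) E[xᵀ Λ_k x] is split off so that it can
combine with L_k - Λ_k to give K_k. -/
theorem IsNoiseModel.expected_penalty (hS : S.IsValid) (h : S.IsNoiseModel μ w τ τ₀)
    (hpq : S.p = 1 - S.q) (hM : 1 ≤ S.M) (hMN : S.M ≤ S.N) (hπ : S.IsFeasible π)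
    (hu : ∀ k < S.N, MemLp (S.controlProc w τ x₀ π k) 2 μ) {k : ℕ} (hk : k < S.N) (hk0 : 0 < k)
    (hd : S.M ∣ k) :
    ∫ ω, (S.controlProc w τ x₀ π k ω + S.V k *ᵥ S.stateProc w τ x₀ π k ω) ⬝ᵥ
        (S.controlWeight k *ᵥ
          (S.controlProc w τ x₀ π k ω + S.V k *ᵥ S.stateProc w τ x₀ π k ω)) ∂μ =
      (1 - S.p) * ∫ ω, S.stateProc w τ x₀ π k ω ⬝ᵥ
        (S.Lam k *ᵥ S.stateProc w τ x₀ π k ω) ∂μ +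
      ∫ ω, S.deviation w τ x₀ π k ω ⬝ᵥ (S.controlWeight k *ᵥ S.deviation w τ x₀ π k ω) ∂μ +
      S.penaltyConst μ w τ x₀ k := by
  have hMk := Nat.le_of_dvd hk0 hd
  have hsub : k - S.M + S.M = k := Nat.sub_add_cancel hMk
  have hx : MemLp (S.stateProc w τ x₀ π k) 2 μ :=
    h.memLp_stateProc hk.le fun j hj => hu j (by omega)
  have hD := memLp_deviation h hu hk
  have hDm : Measurable[noiseSigma w τ (k - S.M) S.N] (S.deviation w τ x₀ π k) :=
    (measurable_deviation hπ hM hk).mono (noiseSigma_mono le_rfl (by omega)) le_rfl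
  have hE := h.memLp_predictError (i := k - S.M) (j := S.M) (by omega)
  have hχ0 : Measurable fun b : Bool => if b = true then (1 : ℝ) else 0 := measurable_of_finite _
  have hχm : Measurable[noiseSigma w τ (k - S.M) S.N]
      fun ω => if τ (k - S.MB) ω = true then (1 : ℝ) else 0 :=
    hχ0.comp (measurable_τ_noiseSigma (by omega))
  have hχ : ∀ ω, ‖if τ (k - S.MB) ω = true then (1 : ℝ) else 0‖ ≤ 1 := by
    intro ω; split_ifs <;> simp
  have h_int : ∀ {f : Ω → ℝ}, Integrable f μ →
      Integrable (fun ω => (if τ (k - S.MB) ω = true then (1 : ℝ) else 0) * f ω) μ := fun hf =>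
    hf.bdd_mul (hχm.mono (h.noiseSigma_le (by omega) le_rfl) le_rfl).aestronglyMeasurable
      (ae_of_all _ hχ)
  have hFm : Measurable[noiseSigma w τ (k - S.M) S.N]
      fun ω => (S.controlWeight k * S.V k)ᵀ *ᵥ S.deviation w τ x₀ π k ω :=
    (measurable_mulVec _).comp hDm
  have hcross := h.integral_dotProduct_predictError (j := S.M) (by omega) hFm
    (hD.matrix_mulVec (S.controlWeight k * S.V k)ᵀ)
  have hcM := le_c_mul_M hM hMN hk hd
  have herr := h.integral_mul_quadratic_predictError (Nat.dvd_sub hd dvd_rfl) le_rfl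
    (by omega) (by omega) hχm hχ
  have hP : S.P k = S.Lam k := by
    rcases hcM.lt_or_eq with hlt | heq
    · rw [S.P_of_lt k hlt, if_pos hd]
    · rw [heq, S.P_last]
  rw [hsub, hP] at herr
  have i1 := integrable_quadratic hD (S.controlWeight k)
  have i2 := ((hD.matrix_mulVec (S.controlWeight k * S.V k)ᵀ).integrable_dotProduct hE).const_mul 2
  have i3 := h_int (integrable_quadratic hE (S.Lam k))
  have i4 := integrable_quadratic hx (S.Lam k)
  have i5 := h_int i4
  have i45 : Integrable (fun ω => S.stateProc w τ x₀ π k ω ⬝ᵥ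
      (S.Lam k *ᵥ S.stateProc w τ x₀ π k ω) -
      (if τ (k - S.MB) ω = true then (1 : ℝ) else 0) * (S.stateProc w τ x₀ π k ω ⬝ᵥ
        (S.Lam k *ᵥ S.stateProc w τ x₀ π k ω))) μ := i4.sub i5
  simp only [penalty_eq hS hπ hk hk0 hd]
  rw [integral_add ((i1.fun_add i2).fun_add i3) i45,
    integral_add (i1.fun_add i2) i3, integral_add i1 i2, integral_sub i4 i5, integral_const_mul,
    hcross, herr, penaltyConst, ← h.off_correction_eq hpq hM hπ hk hk0 hd]
  ring

theorem IsNoiseModel.expected_stage (hS : S.IsValid) (h : S.IsNoiseModel μ w τ τ₀)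
    (hM : 1 ≤ S.M) (hπ : S.IsFeasible π)
    (hu : ∀ k < S.N, MemLp (S.controlProc w τ x₀ π k) 2 μ) {k : ℕ} (hk : k < S.N) :
    ∫ ω, (S.stateProc w τ x₀ π k ω ⬝ᵥ (S.Q k *ᵥ S.stateProc w τ x₀ π k ω) +
        S.controlProc w τ x₀ π k ω ⬝ᵥ (S.R k *ᵥ S.controlProc w τ x₀ π k ω)) ∂μ +
      ∫ ω, S.stateProc w τ x₀ π (k + 1) ω ⬝ᵥ
        (S.K (k + 1) *ᵥ S.stateProc w τ x₀ π (k + 1) ω) ∂μ =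
    ∫ ω, S.stateProc w τ x₀ π k ω ⬝ᵥ (S.L k *ᵥ S.stateProc w τ x₀ π k ω) ∂μ -
      ∫ ω, S.stateProc w τ x₀ π k ω ⬝ᵥ (S.Lam k *ᵥ S.stateProc w τ x₀ π k ω) ∂μ +
      ∫ ω, (S.controlProc w τ x₀ π k ω + S.V k *ᵥ S.stateProc w τ x₀ π k ω) ⬝ᵥ
        (S.controlWeight k *ᵥ
          (S.controlProc w τ x₀ π k ω + S.V k *ᵥ S.stateProc w τ x₀ π k ω)) ∂μ +
      (S.K (k + 1) * S.W k).trace := by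
  have hK := (posSemidef_K hS (k := k + 1) hk).1
  have hG := posDef_controlWeight' hS hk
  have hx : MemLp (S.stateProc w τ x₀ π k) 2 μ :=
    h.memLp_stateProc hk.le fun j hj => hu j (by omega)
  have hum := hu k hk
  have hMB : S.MB ≤ S.M := Nat.le_add_left _ _
  have hxm : Measurable[noiseSigma w τ k S.N] (S.stateProc w τ x₀ π k) :=
    ((measurable_state_and_control hπ hM k).1 hk.le).mono
      (noiseSigma_mono le_rfl (by omega)) le_rfl
  have hu_m : Measurable[noiseSigma w τ k S.N] (S.controlProc w τ x₀ π k) :=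
    ((measurable_state_and_control hπ hM k).2 hk).mono
      (noiseSigma_mono (by omega) (by omega)) le_rfl
  have hstep := h.integral_mul_quadratic_add_w hk (χ := fun _ => 1)
    (@measurable_const _ _ _ (noiseSigma w τ k S.N) _) (by simp)
    (y := fun ω => S.A k *ᵥ S.stateProc w τ x₀ π k ω + S.B k *ᵥ S.controlProc w τ x₀ π k ω)
    (((measurable_mulVec _).comp hxm).add ((measurable_mulVec _).comp hu_m))
    ((hx.matrix_mulVec _).add (hum.matrix_mulVec _)) (S.K (k + 1))
  simp only [one_mul, integral_const, probReal_univ, one_smul, ← stateProc_succ] at hstep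
  rw [hstep]
  have i1 := integrable_quadratic hx (S.Q k)
  have i2 := integrable_quadratic hum (S.R k)
  have i3 : Integrable (fun ω =>
      (S.A k *ᵥ S.stateProc w τ x₀ π k ω + S.B k *ᵥ S.controlProc w τ x₀ π k ω) ⬝ᵥ
      (S.K (k + 1) *ᵥ
        (S.A k *ᵥ S.stateProc w τ x₀ π k ω + S.B k *ᵥ S.controlProc w τ x₀ π k ω))) μ :=
    integrable_quadratic ((hx.matrix_mulVec (S.A k)).add (hum.matrix_mulVec (S.B k))) _
  have i4 := integrable_quadratic hx (S.L k)
  have i5 := integrable_quadratic hx (S.Lam k)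
  have i6 : Integrable (fun ω =>
      (S.controlProc w τ x₀ π k ω + S.V k *ᵥ S.stateProc w τ x₀ π k ω) ⬝ᵥ
      (S.controlWeight k *ᵥ
        (S.controlProc w τ x₀ π k ω + S.V k *ᵥ S.stateProc w τ x₀ π k ω))) μ :=
    integrable_quadratic (hum.add (hx.matrix_mulVec (S.V k))) _
  have i45 : Integrable (fun ω =>
      S.stateProc w τ x₀ π k ω ⬝ᵥ (S.L k *ᵥ S.stateProc w τ x₀ π k ω) -
      S.stateProc w τ x₀ π k ω ⬝ᵥ (S.Lam k *ᵥ S.stateProc w τ x₀ π k ω)) μ := i4.sub i5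
  rw [← add_assoc, ← integral_add (i1.fun_add i2) i3]
  simp only [stage_cost_eq hK hG]
  rw [integral_add i45 i6, integral_sub i4 i5]

variable (S μ w τ x₀) in
/-- The policy-independent part of the expected total cost. -/
def baseCost : ℝ :=
  x₀ ⬝ᵥ (S.L 0 *ᵥ x₀) + ∑ k ∈ Finset.range S.N, (S.K (k + 1) * S.W k).trace +
    ∑ k ∈ Finset.range S.N, if 0 < k ∧ S.M ∣ k then S.penaltyConst μ w τ x₀ k else 0

theorem integrable_pathCost (h : S.IsNoiseModel μ w τ τ₀)
    (hu : ∀ k < S.N, MemLp (S.controlProc w τ x₀ π k) 2 μ) :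
    Integrable (fun ω => S.pathCost (fun k => S.stateProc w τ x₀ π k ω)
      (fun k => S.controlProc w τ x₀ π k ω)) μ := by
  have hx : ∀ k ≤ S.N, MemLp (S.stateProc w τ x₀ π k) 2 μ := fun k hk =>
    h.memLp_stateProc hk fun j hj => hu j (by omega)
  refine (integrable_quadratic (hx S.N le_rfl) _).add (integrable_finsetSum _ fun k hk => ?_)
  have hk := Finset.mem_range.mp hk
  exact (integrable_quadratic (hx k hk.le) _).add (integrable_quadratic (hu k hk) _)

/-- The expected cost is a constant plus a nonnegative penalty for deviating from the linear
law. -/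
theorem IsNoiseModel.integral_pathCost (hS : S.IsValid) (h : S.IsNoiseModel μ w τ τ₀)
    (hpq : S.p = 1 - S.q) (hM : 1 ≤ S.M) (hMN : S.M ≤ S.N) (hπ : S.IsFeasible π)
    (hu : ∀ k < S.N, MemLp (S.controlProc w τ x₀ π k) 2 μ) :
    ∫ ω, S.pathCost (fun k => S.stateProc w τ x₀ π k ω)
        (fun k => S.controlProc w τ x₀ π k ω) ∂μ =
      S.baseCost μ w τ x₀ + ∑ k ∈ Finset.range S.N, ∫ ω, S.deviation w τ x₀ π k ω ⬝ᵥ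
        (S.controlWeight k *ᵥ S.deviation w τ x₀ π k ω) ∂μ := by
  have hx : ∀ k ≤ S.N, MemLp (S.stateProc w τ x₀ π k) 2 μ := fun k hk =>
    h.memLp_stateProc hk fun j hj => hu j (by omega)
  have istage : ∀ k ∈ Finset.range S.N, Integrable (fun ω =>
      S.stateProc w τ x₀ π k ω ⬝ᵥ (S.Q k *ᵥ S.stateProc w τ x₀ π k ω) +
        S.controlProc w τ x₀ π k ω ⬝ᵥ (S.R k *ᵥ S.controlProc w τ x₀ π k ω)) μ := by
    intro k hk
    have hk := Finset.mem_range.mp hk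
    exact (integrable_quadratic (hx k hk.le) _).add (integrable_quadratic (hu k hk) _)
  simp only [pathCost]
  rw [integral_add (integrable_quadratic (hx S.N le_rfl) _) (integrable_finsetSum _ istage),
    integral_finsetSum _ istage]
  set T : ℕ → ℝ := fun k => ∫ ω, S.stateProc w τ x₀ π k ω ⬝ᵥ
    (S.K k *ᵥ S.stateProc w τ x₀ π k ω) ∂μ with hT
  -- The T k telescope. The extra term at k = 0 corrects for K_0 = L_0 - p Λ_0: the recursion counts
  -- 0 as a multiple of M, but no control is applied at time 0.
  have hstep : ∀ k ∈ Finset.range S.N,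
      ∫ ω, (S.stateProc w τ x₀ π k ω ⬝ᵥ (S.Q k *ᵥ S.stateProc w τ x₀ π k ω) +
        S.controlProc w τ x₀ π k ω ⬝ᵥ (S.R k *ᵥ S.controlProc w τ x₀ π k ω)) ∂μ =
      -(T (k + 1) - T k) + (if k = 0 then x₀ ⬝ᵥ (S.L 0 *ᵥ x₀) - T 0 else 0) +
      (S.K (k + 1) * S.W k).trace +
      (if 0 < k ∧ S.M ∣ k then S.penaltyConst μ w τ x₀ k else 0) +
      ∫ ω, S.deviation w τ x₀ π k ω ⬝ᵥ
        (S.controlWeight k *ᵥ S.deviation w τ x₀ π k ω) ∂μ := by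
    intro k hk
    have hk := Finset.mem_range.mp hk
    have hst := h.expected_stage hS hM hπ hu hk
    have hK := (posSemidef_K hS (k := k + 1) hk).1
    have hG := posDef_controlWeight' hS hk
    have iL := integrable_quadratic (hx k hk.le) (S.L k)
    have iΛ := integrable_quadratic (hx k hk.le) (S.Lam k)
    -- At an arrival, -Λ_k + (1 - p) Λ_k = -p Λ_k. Otherwise u = 0, and the penalty cancels -Λ_k
    -- entirely.
    by_cases hc : 0 < k ∧ S.M ∣ k
    · have hpen := h.expected_penalty hS hpq hM hMN hπ hu hk hc.1 hc.2
      have hTk : T k = ∫ ω, S.stateProc w τ x₀ π k ω ⬝ᵥ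
            (S.L k *ᵥ S.stateProc w τ x₀ π k ω) ∂μ -
          S.p * ∫ ω, S.stateProc w τ x₀ π k ω ⬝ᵥ
            (S.Lam k *ᵥ S.stateProc w τ x₀ π k ω) ∂μ := by
        rw [← integral_const_mul, ← integral_sub iL (iΛ.const_mul _)]
        simp only [hT, S.K_of_lt k hk, if_pos hc.2, sub_mulVec, smul_mulVec, dotProduct_sub,
          dotProduct_smul, smul_eq_mul]
      rw [if_pos hc, if_neg (by omega)]
      simp only [hT] at hTk ⊢
      linarith
    · simp only [controlProc_eq_zero hπ hk hc, zero_add, ← dotProduct_Lam hK hG] at hst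
      simp only [deviation_eq_zero hπ hk hc, zero_dotProduct, integral_zero, add_zero, if_neg hc,
        controlProc_eq_zero hπ hk hc]
      simp only [zero_dotProduct, add_zero] at hst
      rcases Nat.eq_zero_or_pos k with rfl | hk0
      · have h0 : ∀ ω, S.stateProc w τ x₀ π 0 ω = x₀ := fun ω => rfl
        simp only [h0, integral_const, probReal_univ, one_smul, zero_add] at hst
        simp only [if_true, hT, h0, integral_const, probReal_univ, one_smul, zero_add]
        linarith
      · have hd : ¬ S.M ∣ k := fun hd => hc ⟨hk0, hd⟩
        have hTk : T k = ∫ ω, S.stateProc w τ x₀ π k ω ⬝ᵥ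
            (S.L k *ᵥ S.stateProc w τ x₀ π k ω) ∂μ := by
          simp only [hT, S.K_of_lt k hk, if_neg hd]
        rw [if_neg (by omega)]
        simp only [hT] at hTk ⊢
        linarith
  rw [Finset.sum_congr rfl hstep]
  simp only [Finset.sum_add_distrib, Finset.sum_neg_distrib, Finset.sum_range_sub]
  rw [Finset.sum_ite_eq' (Finset.range S.N) 0 fun _ => x₀ ⬝ᵥ (S.L 0 *ᵥ x₀) - T 0,
    if_pos (Finset.mem_range.mpr (by omega)), baseCost]
  have hTN : T S.N = ∫ ω, S.stateProc w τ x₀ π S.N ω ⬝ᵥ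
    (S.Q S.N *ᵥ S.stateProc w τ x₀ π S.N ω) ∂μ := by simp only [hT, S.K_N]
  rw [hTN]
  ring

end cost

/-! ### Optimality, uniqueness and the conditional mean. -/

theorem pathCost_nonneg (hS : S.IsValid) (x : ℕ → Fin n → ℝ) (u : ℕ → Fin s → ℝ) :
    0 ≤ S.pathCost x u := by
  have hQ : ∀ k ≤ S.N, 0 ≤ x k ⬝ᵥ (S.Q k *ᵥ x k) := fun k hk => by
    simpa using (hS.posSemidef_Q k hk).dotProduct_mulVec_nonneg (x k)
  refine add_nonneg (hQ _ le_rfl) (Finset.sum_nonneg fun k hk => ?_)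
  have hk := Finset.mem_range.mp hk
  exact add_nonneg (hQ k hk.le)
    (by simpa using (hS.posDef_R k hk).posSemidef.dotProduct_mulVec_nonneg (u k))

theorem control_cost_le_pathCost (hS : S.IsValid) (x : ℕ → Fin n → ℝ) (u : ℕ → Fin s → ℝ) {k : ℕ}
    (hk : k < S.N) : u k ⬝ᵥ (S.R k *ᵥ u k) ≤ S.pathCost x u := by
  have hQ : ∀ k ≤ S.N, 0 ≤ x k ⬝ᵥ (S.Q k *ᵥ x k) := fun k hk => by
    simpa using (hS.posSemidef_Q k hk).dotProduct_mulVec_nonneg (x k)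
  have hR : ∀ k < S.N, 0 ≤ u k ⬝ᵥ (S.R k *ᵥ u k) := fun k hk => by
    simpa using (hS.posDef_R k hk).posSemidef.dotProduct_mulVec_nonneg (u k)
  have h1 := Finset.single_le_sum (f := fun k => x k ⬝ᵥ (S.Q k *ᵥ x k) + u k ⬝ᵥ (S.R k *ᵥ u k))
    (fun j hj => add_nonneg (hQ j (Finset.mem_range.mp hj).le) (hR j (Finset.mem_range.mp hj)))
    (Finset.mem_range.mpr hk)
  have h2 := hQ k hk.le
  have h3 := hQ S.N le_rfl
  simp only [pathCost] at h1 ⊢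
  linarith

theorem deviation_cost_nonneg {w : ℕ → Ω → Fin n → ℝ} {τ : ℕ → Ω → Bool}
    {x₀ : Fin n → ℝ} {π : FogPolicy n s} (hS : S.IsValid) {k : ℕ} (hk : k < S.N) (ω : Ω) :
    0 ≤ S.deviation w τ x₀ π k ω ⬝ᵥ (S.controlWeight k *ᵥ S.deviation w τ x₀ π k ω) := by
  simpa using (posDef_controlWeight' hS hk).posSemidef.dotProduct_mulVec_nonneg
    (S.deviation w τ x₀ π k ω)

section cost

variable [mΩ : MeasurableSpace Ω] {μ : Measure Ω}
  {w : ℕ → Ω → Fin n → ℝ} {τ : ℕ → Ω → Bool} {τ₀ : Bool} {x₀ : Fin n → ℝ} {π : FogPolicy n s}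

theorem IsNoiseModel.measurable_stateProc (h : S.IsNoiseModel μ w τ τ₀) (hM : 1 ≤ S.M)
    (hπ : S.IsFeasible π) {k : ℕ} (hk : k ≤ S.N) : Measurable (S.stateProc w τ x₀ π k) :=
  ((measurable_state_and_control hπ hM k).1 hk).mono (h.noiseSigma_le hk (by omega)) le_rfl

theorem IsNoiseModel.measurable_controlProc (h : S.IsNoiseModel μ w τ τ₀) (hM : 1 ≤ S.M)
    (hπ : S.IsFeasible π) {k : ℕ} (hk : k < S.N) : Measurable (S.controlProc w τ x₀ π k) :=
  ((measurable_state_and_control hπ hM k).2 hk).mono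
    (h.noiseSigma_le (by omega) (by omega)) le_rfl

/-- A policy of finite cost has square integrable controls. -/
theorem IsNoiseModel.memLp_controlProc_of_cost_ne_top (hS : S.IsValid)
    (h : S.IsNoiseModel μ w τ τ₀) (hM : 1 ≤ S.M) (hπ : S.IsFeasible π)
    (hc : S.cost μ w τ x₀ π ≠ ⊤) {k : ℕ} (hk : k < S.N) :
    MemLp (S.controlProc w τ x₀ π k) 2 μ := by
  have hm : Measurable fun ω => S.pathCost (fun k => S.stateProc w τ x₀ π k ω)
      (fun k => S.controlProc w τ x₀ π k ω) := by
    refine ((measurable_quadratic _).comp (h.measurable_stateProc hM hπ le_rfl)).add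
      (Finset.measurable_fun_sum _ fun j hj => ?_)
    have hj := Finset.mem_range.mp hj
    exact ((measurable_quadratic _).comp (h.measurable_stateProc hM hπ hj.le)).add
      ((measurable_quadratic _).comp (h.measurable_controlProc hM hπ hj))
  have h_int : Integrable (fun ω => S.pathCost (fun k => S.stateProc w τ x₀ π k ω)
      (fun k => S.controlProc w τ x₀ π k ω)) μ := by
    refine ⟨hm.aestronglyMeasurable, ?_⟩
    rw [hasFiniteIntegral_iff_ofReal (ae_of_all _ fun ω => pathCost_nonneg hS _ _)]
    exact lt_top_iff_ne_top.mpr hc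
  -- Here r ‖u_k‖² is bounded by the path cost, which is integrable because the cost is finite.
  obtain ⟨r, hr, hle⟩ := (hS.posDef_R k hk).exists_pos_mul_sq_norm_le
  have hum := h.measurable_controlProc (x₀ := x₀) hM hπ hk
  rw [memLp_two_iff_integrable_sq_norm hum.aestronglyMeasurable]
  refine (h_int.const_mul r⁻¹).mono' (hum.norm.pow_const 2).aestronglyMeasurable
    (ae_of_all _ fun ω => ?_)
  have h1 := (hle (S.controlProc w τ x₀ π k ω)).trans (control_cost_le_pathCost hS
    (fun k => S.stateProc w τ x₀ π k ω) (fun k => S.controlProc w τ x₀ π k ω) hk)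
  rw [Real.norm_of_nonneg (by positivity), ← div_eq_inv_mul, le_div_iff₀' hr]
  exact h1

variable [IsProbabilityMeasure μ]

theorem IsNoiseModel.memLp_controlProc_optPolicy (h : S.IsNoiseModel μ w τ τ₀) (hM : 1 ≤ S.M)
    {k : ℕ} (hk : k < S.N) : MemLp (S.controlProc w τ x₀ S.optPolicy k) 2 μ := by
  induction k using Nat.strong_induction_on with
  | _ k ih =>
    by_cases hc : 0 < k ∧ S.M ∣ k
    · have heq : S.controlProc w τ x₀ S.optPolicy k = _ :=
        funext fun ω => controlProc_optPolicy hM k ω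
      rw [heq]
      exact memLp_optLaw (h.memLp_stateProc (by omega) fun j hj => ih j (by omega) (by omega))
        (ih _ (by omega) (by omega)) (h.measurable_τ _ (by omega)) k
    · have heq : S.controlProc w τ x₀ S.optPolicy k = fun _ => 0 :=
        funext fun ω => controlProc_eq_zero isFeasible_optPolicy hk hc ω
      rw [heq]
      exact MemLp.zero

theorem IsNoiseModel.cost_eq (hS : S.IsValid) (h : S.IsNoiseModel μ w τ τ₀)
    (hpq : S.p = 1 - S.q) (hM : 1 ≤ S.M) (hMN : S.M ≤ S.N) (hπ : S.IsFeasible π)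
    (hu : ∀ k < S.N, MemLp (S.controlProc w τ x₀ π k) 2 μ) :
    S.cost μ w τ x₀ π = ENNReal.ofReal (S.baseCost μ w τ x₀ +
      ∑ k ∈ Finset.range S.N, ∫ ω, S.deviation w τ x₀ π k ω ⬝ᵥ
        (S.controlWeight k *ᵥ S.deviation w τ x₀ π k ω) ∂μ) := by
  rw [← h.integral_pathCost hS hpq hM hMN hπ hu, ofReal_integral_eq_lintegral_ofReal
    (integrable_pathCost h hu) (ae_of_all _ fun ω => pathCost_nonneg hS _ _)]
  rfl

theorem IsNoiseModel.cost_optPolicy (hS : S.IsValid) (h : S.IsNoiseModel μ w τ τ₀)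
    (hpq : S.p = 1 - S.q) (hM : 1 ≤ S.M) (hMN : S.M ≤ S.N) :
    S.cost μ w τ x₀ S.optPolicy = ENNReal.ofReal (S.baseCost μ w τ x₀) := by
  rw [h.cost_eq hS hpq hM hMN isFeasible_optPolicy fun k hk => h.memLp_controlProc_optPolicy hM hk]
  simp [deviation_optPolicy hM]

/-- The constant is the integral of the nonnegative path cost under the linear law. This sign is
needed to cancel `ENNReal.ofReal`, which truncates negative numbers. -/
theorem IsNoiseModel.baseCost_nonneg (hS : S.IsValid) (h : S.IsNoiseModel μ w τ τ₀)
    (hpq : S.p = 1 - S.q) (hM : 1 ≤ S.M) (hMN : S.M ≤ S.N) : 0 ≤ S.baseCost μ w τ x₀ := by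
  have h1 := h.integral_pathCost (x₀ := x₀) hS hpq hM hMN isFeasible_optPolicy
    fun k hk => h.memLp_controlProc_optPolicy hM hk
  simp only [deviation_optPolicy hM, zero_dotProduct, integral_zero, Finset.sum_const_zero,
    add_zero] at h1
  rw [← h1]
  exact integral_nonneg fun ω => pathCost_nonneg hS _ _

/-- Policies of infinite cost are trivially no better; for the others the controls are square
integrable, and the deviation penalties are nonnegative. -/
theorem IsNoiseModel.minCost_eq (hS : S.IsValid) (h : S.IsNoiseModel μ w τ τ₀)
    (hpq : S.p = 1 - S.q) (hM : 1 ≤ S.M) (hMN : S.M ≤ S.N) :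
    S.minCost μ w τ x₀ = ENNReal.ofReal (S.baseCost μ w τ x₀) := by
  apply le_antisymm
  · rw [← h.cost_optPolicy hS hpq hM hMN]
    exact iInf₂_le S.optPolicy isFeasible_optPolicy
  · refine le_iInf₂ fun π hπ => ?_
    by_cases hc : S.cost μ w τ x₀ π = ⊤
    · rw [hc]; exact le_top
    · rw [h.cost_eq hS hpq hM hMN hπ fun k hk =>
        h.memLp_controlProc_of_cost_ne_top hS hM hπ hc hk]
      refine ENNReal.ofReal_le_ofReal (le_add_of_nonneg_right (Finset.sum_nonneg fun k hk => ?_))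
      exact integral_nonneg fun ω => deviation_cost_nonneg hS (Finset.mem_range.mp hk) ω

/-- A policy attaining the minimum follows the linear law almost surely. -/
theorem IsNoiseModel.deviation_ae_eq_zero (hS : S.IsValid) (h : S.IsNoiseModel μ w τ τ₀)
    (hpq : S.p = 1 - S.q) (hM : 1 ≤ S.M) (hMN : S.M ≤ S.N) (hπ : S.IsFeasible π)
    (hc : S.cost μ w τ x₀ π = S.minCost μ w τ x₀) {k : ℕ} (hk : k < S.N) :
    ∀ᵐ ω ∂μ, S.deviation w τ x₀ π k ω = 0 := by
  have hmin := h.minCost_eq (x₀ := x₀) hS hpq hM hMN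
  have hu : ∀ k < S.N, MemLp (S.controlProc w τ x₀ π k) 2 μ := fun k hk =>
    h.memLp_controlProc_of_cost_ne_top hS hM hπ (by rw [hc, hmin]; exact ENNReal.ofReal_ne_top) hk
  have hnn : ∀ j ∈ Finset.range S.N, 0 ≤ ∫ ω, S.deviation w τ x₀ π j ω ⬝ᵥ
      (S.controlWeight j *ᵥ S.deviation w τ x₀ π j ω) ∂μ := fun j hj =>
    integral_nonneg fun ω => deviation_cost_nonneg hS (Finset.mem_range.mp hj) ω
  rw [h.cost_eq hS hpq hM hMN hπ hu, hmin, ENNReal.ofReal_eq_ofReal_iff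
    (add_nonneg (h.baseCost_nonneg hS hpq hM hMN) (Finset.sum_nonneg hnn))
    (h.baseCost_nonneg hS hpq hM hMN), add_eq_left, Finset.sum_eq_zero_iff_of_nonneg hnn] at hc
  have hz := (integral_eq_zero_iff_of_nonneg (fun ω => deviation_cost_nonneg hS hk ω)
    (integrable_quadratic (memLp_deviation h hu hk) _)).mp (hc k (Finset.mem_range.mpr hk))
  filter_upwards [hz] with ω hω
  by_contra hne
  have := (posDef_controlWeight' hS hk).dotProduct_mulVec_pos hne
  simp only [star_trivial] at this
  exact this.ne' hω

/-- Zero deviation only says that the policy obeys the linear law along its own trajectory. Off a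
single null set, induction on time identifies this trajectory with that of `optPolicy`. -/
theorem IsNoiseModel.controlProc_ae_eq (hS : S.IsValid) (h : S.IsNoiseModel μ w τ τ₀)
    (hpq : S.p = 1 - S.q) (hM : 1 ≤ S.M) (hMN : S.M ≤ S.N) (hπ : S.IsFeasible π)
    (hc : S.cost μ w τ x₀ π = S.minCost μ w τ x₀) {k : ℕ} (hk : k < S.N) :
    ∀ᵐ ω ∂μ, S.controlProc w τ x₀ π k ω = S.controlProc w τ x₀ S.optPolicy k ω := by
  have hdev : ∀ᵐ ω ∂μ, ∀ k, k < S.N → S.deviation w τ x₀ π k ω = 0 :=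
    ae_all_iff.mpr fun k => by
      by_cases hk : k < S.N
      · simpa [hk] using h.deviation_ae_eq_zero hS hpq hM hMN hπ hc hk
      · simp [hk]
  filter_upwards [hdev] with ω hω
  have key : ∀ k, (k ≤ S.N →
      S.stateProc w τ x₀ π k ω = S.stateProc w τ x₀ S.optPolicy k ω) ∧
      (k < S.N → S.controlProc w τ x₀ π k ω = S.controlProc w τ x₀ S.optPolicy k ω) := by
    intro k
    induction k using Nat.strong_induction_on with
    | _ k ih =>
      constructor
      · intro hk
        cases k with
        | zero => rfl
        | succ k =>
          rw [stateProc_succ, stateProc_succ, (ih k (by omega)).1 (by omega),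
            (ih k (by omega)).2 (by omega)]
      · intro hk
        by_cases hc : 0 < k ∧ S.M ∣ k
        · have hd := sub_eq_zero.mp (hω k hk)
          rw [hd, controlProc_optPolicy hM k ω, (ih (k - S.M) (by omega)).1 (by omega),
            (ih (k - S.M) (by omega)).2 (by omega)]
        · rw [controlProc_eq_zero hπ hk hc, controlProc_eq_zero isFeasible_optPolicy hk hc]
  exact (key k).2 hk

/-- The conditional mean of the state given the state and the control `M` steps earlier is the
linear predictor. -/
theorem IsNoiseModel.condMean_ae_eq (h : S.IsNoiseModel μ w τ τ₀) (hM : 1 ≤ S.M)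
    (hπ : S.IsFeasible π) (hu : ∀ k < S.N, MemLp (S.controlProc w τ x₀ π k) 2 μ) {k : ℕ}
    (hk : k < S.N) (hk0 : 0 < k) (hd : S.M ∣ k) :
    S.condMean μ w τ x₀ π k =ᵐ[μ] fun ω => S.predict (k - S.M)
      (S.stateProc w τ x₀ π (k - S.M) ω) (S.controlProc w τ x₀ π (k - S.M) ω) S.M := by
  have hMk := Nat.le_of_dvd hk0 hd
  have hx : ∀ k ≤ S.N, MemLp (S.stateProc w τ x₀ π k) 2 μ := fun k hk =>
    h.memLp_stateProc hk fun j hj => hu j (by omega)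
  have hpred := memLp_predict (S := S) (hx (k - S.M) (by omega)) (hu (k - S.M) (by omega))
    (k - S.M) S.M
  have hE := h.memLp_predictError (i := k - S.M) (j := S.M) (by omega)
  have hxadd : ∀ ω, S.stateProc w τ x₀ π k ω = S.predict (k - S.M)
      (S.stateProc w τ x₀ π (k - S.M) ω) (S.controlProc w τ x₀ π (k - S.M) ω) S.M +
      S.predictError w (k - S.M) S.M ω := by
    intro ω
    have := stateProc_add (w := w) (τ := τ) (x₀ := x₀) hπ (Nat.dvd_sub hd dvd_rfl) le_rfl
      (by omega : k - S.M + S.M ≤ S.N) ω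
    rwa [Nat.sub_add_cancel hMk] at this
  set lam : Ω → (Fin n → ℝ) × (Fin s → ℝ) := fun ω =>
    (S.stateProc w τ x₀ π (k - S.M) ω, S.controlProc w τ x₀ π (k - S.M) ω) with hlam
  have hlamm : Measurable[noiseSigma w τ (k - S.M) S.N] lam := by
    refine Measurable.prodMk ?_ ?_
    · exact ((measurable_state_and_control hπ hM (k - S.M)).1 (by omega)).mono
        (noiseSigma_mono le_rfl (by omega)) le_rfl
    · exact ((measurable_state_and_control hπ hM (k - S.M)).2 (by omega)).mono
        (noiseSigma_mono (by omega) (by omega)) le_rfl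
  have hle := h.noiseSigma_le (a := k - S.M) (by omega) le_rfl
  have hcomap : MeasurableSpace.comap lam inferInstance ≤ mΩ := hlamm.comap_le.trans hle
  symm
  refine ae_eq_condExp_of_forall_setIntegral_eq hcomap ((hx k hk.le).integrable (by norm_num))
    (fun _ _ _ => (hpred.integrable (by norm_num)).integrableOn) (fun A hA _ => ?_) ?_
  · have hAm : MeasurableSet A := hcomap A hA
    simp only [hxadd]
    rw [integral_add (hpred.integrable (by norm_num)).integrableOn
      (hE.integrable (by norm_num)).integrableOn, left_eq_add]
    -- Coordinate a of the error, integrated over A, is its pairing with the vector 1_A e_a. This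
    -- vector is determined by the noise before the block, so the integral is zero.
    ext a
    rw [eval_integral fun b => ((hE.integrable (by norm_num)).eval b).integrableOn,
      ← integral_indicator hAm]
    have hFm : Measurable[noiseSigma w τ (k - S.M) S.N]
        (A.indicator fun _ => (Pi.single a 1 : Fin n → ℝ)) :=
      (@measurable_const _ _ _ (noiseSigma w τ (k - S.M) S.N) _).indicator (hlamm.comap_le A hA)
    have hF : MemLp (A.indicator fun _ => (Pi.single a 1 : Fin n → ℝ)) 2 μ :=
      (memLp_const _).indicator hAm
    rw [Pi.zero_apply, ← h.integral_dotProduct_predictError (i := k - S.M) (j := S.M)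
      (by omega) hFm hF]
    congr 1
    ext ω
    by_cases hωA : ω ∈ A <;> simp [hωA]
  · exact ((measurable_predict (S := S) (k - S.M) S.M).comp
      (comap_measurable lam)).aestronglyMeasurable

/-- If MF ≥ 1, then k - MB > 0 at every arrival time; if N = M, there is no arrival before N. So τ_0
never gates a control, each gate has probability p, and the correction in `penaltyConst` vanishes.
-/
theorem IsNoiseModel.baseCost_eq_optValue (h : S.IsNoiseModel μ w τ τ₀)
    (hpq : S.p = 1 - S.q) (hM : 1 ≤ S.M) (hMN : S.M ≤ S.N) (hMF : 1 ≤ S.MF ∨ S.N = S.M) :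
    S.baseCost μ w τ x₀ = S.optValue x₀ := by
  rw [baseCost, optValue, ← sum_arrivals_eq hM hMN fun i => (S.P (i + 1) * S.W i).trace,
    Finset.mul_sum]
  congr 1
  refine Finset.sum_congr rfl fun k hk => ?_
  have hk := Finset.mem_range.mp hk
  split_ifs with hc
  · have hMk := Nat.le_of_dvd hc.1 hc.2
    have hMM : S.MF + S.MB = S.M := rfl
    have h0 : 0 < k - S.MB := by omega
    have hon := h.integral_on_mul hpq h0 (by omega) (f := fun _ => 1)
      (@measurable_const _ _ _ (noiseSigma w τ S.N (k - S.MB)) _)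
    simp only [mul_one, integral_const, probReal_univ, one_smul] at hon
    rw [penaltyConst, h.integral_on_mul_state hpq hM isFeasible_zero hk h0, sub_self, add_zero,
      hon]
  · rw [mul_zero]

end cost

end FogSystem
end

/-! ### The main theorem. -/

theorem theorem5 {n s : ℕ} (S : FogSystem n s) (hS : S.IsValid)
    (hpq : S.p = 1 - S.q) (hM : 1 ≤ S.M) (hMN : S.M ≤ S.N)
    {Ω : Type*} [MeasurableSpace Ω] (μ : Measure Ω) [IsProbabilityMeasure μ]
    (w : ℕ → Ω → Fin n → ℝ) (τ : ℕ → Ω → Bool) (x₀ : Fin n → ℝ) (τ₀ : Bool)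
    (hnoise : S.IsNoiseModel μ w τ τ₀) :
    -- the policy is feasible and attains the minimum cost
    S.IsFeasible S.optPolicy ∧
    S.cost μ w τ x₀ S.optPolicy = S.minCost μ w τ x₀ ∧
    -- the controls that it applies
    (∀ k, 1 ≤ k → k < S.N →
      (¬ S.M ∣ k → ∀ ω, S.controlProc w τ x₀ S.optPolicy k ω = 0) ∧
      (S.M ∣ k →
        (∀ ω, S.controlProc w τ x₀ S.optPolicy k ω =
          S.optLaw k (S.stateProc w τ x₀ S.optPolicy (k - S.M) ω,
            S.controlProc w τ x₀ S.optPolicy (k - S.M) ω) (τ (k - S.MB) ω)) ∧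
        ∀ᵐ ω ∂μ, S.controlProc w τ x₀ S.optPolicy k ω =
          if τ (k - S.MB) ω = true then
            -(S.V k *ᵥ S.condMean μ w τ x₀ S.optPolicy k ω)
          else 0)) ∧
    -- every feasible policy attaining the minimum applies almost surely the same controls
    (∀ π : FogPolicy n s, S.IsFeasible π → S.cost μ w τ x₀ π = S.minCost μ w τ x₀ →
      ∀ k < S.N, ∀ᵐ ω ∂μ,
        S.controlProc w τ x₀ π k ω = S.controlProc w τ x₀ S.optPolicy k ω) ∧
    -- the minimum cost
    S.minCost μ w τ x₀ ≠ ⊤ ∧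
    (1 ≤ S.MF ∨ S.N = S.M → (S.minCost μ w τ x₀).toReal = S.optValue x₀) := by
  have hmin := hnoise.minCost_eq (x₀ := x₀) hS hpq hM hMN
  refine ⟨FogSystem.isFeasible_optPolicy, ?_, fun k hk1 hk => ⟨fun hd ω => ?_, fun hd => ⟨?_, ?_⟩⟩,
    fun π hπ hc k hk => hnoise.controlProc_ae_eq hS hpq hM hMN hπ hc hk, ?_, fun hMF => ?_⟩
  · rw [hmin, hnoise.cost_optPolicy hS hpq hM hMN]
  · exact FogSystem.controlProc_eq_zero FogSystem.isFeasible_optPolicy hk (fun h => hd h.2) ω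
  · exact fun ω => FogSystem.controlProc_optPolicy hM k ω
  · filter_upwards [hnoise.condMean_ae_eq hM FogSystem.isFeasible_optPolicy
      (fun j hj => hnoise.memLp_controlProc_optPolicy hM hj) hk hk1 hd] with ω hω
    rw [FogSystem.controlProc_optPolicy hM k ω, hω, FogSystem.optLaw]
    simp only [hd, show 0 < k from hk1, true_and]
  · rw [hmin]
    exact ENNReal.ofReal_ne_top
  · rw [hmin, ENNReal.toReal_ofReal (hnoise.baseCost_nonneg hS hpq hM hMN),
      hnoise.baseCost_eq_optValue hpq hM hMN hMF]
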